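/- Let $r\ge 1$ be an integer and let $S:\mathbb R^{r+1}\to\mathbb R$ be of the form $S(\xi_0,\dots,\xi_r)=\sum_{j=1}^r f_j(\xi_0,\xi_j)$, where $f_1,\dots,f_r\in C^2(\mathbb R^2)$ satisfy, for some constants $K,\lambda>0$ and all $1\le j\le r$: (1) $f_j(\nu+1,\mu+1)=f_j(\nu,\mu)$; (2) all second partial derivatives of $f_j$ are bounded in absolute value by $K/r$; (3) $f_j(\nu,\mu)\to\infty$ as $|\nu-\mu|\to\infty$; (4) (weak twist) $\partial_1\partial_2 f_j\le 0$ everywhere, and $\partial_1\partial_2 f_1\le-\lambda$ everywhere. For $x\in\mathbb R^{\mathbb Z}$ put $S_i(x)=S(x_i,\dots,x_{i+r})$, and for $k,l\in\mathbb Z$ let $(\tau_{k,l}x)_i=x_{i-k}+l$. Write $x\le y$ if $x_i\le y_i$ for all $i$, $x<y$ if $x\le y$ and $x\ne y$, and $x\ll y$ if $x_i<y_i$ for all $i$. A sequence $x$ is a *global minimizer* if for all integers $i_0\le i_1$ and all $v\in\mathbb R^{\mathbb Z}$ supported in $[i_0,i_1]$ one has $\sum_{i=i_0-r}^{i_1}S_i(x)\le\sum_{i=i_0-r}^{i_1}S_i(x+v)$;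 it is *Birkhoff* if for all $k,l\in\mathbb Z$ one has $\tau_{k,l}x\le x$ or $\tau_{k,l}x\ge x$; it has *rotation number* $\nu$ if $x_n/n\to\nu$ as $n\to\pm\infty$. For integers $p\ge1$ and $q$, let $\mathcal M_{p,q}$ be the set of minimizers of $\sum_{i=1}^pS_i$ over the set $\{x\in\mathbb R^{\mathbb Z}:\tau_{p,q}x=x\}$, and let $\mathcal{BM}^+_{q/p}$ (respectively $\mathcal{BM}^-_{q/p}$) be the set of Birkhoff global minimizers $x$ of rotation number $q/p$ with $\tau_{p,q}x\ge x$ (respectively $\tau_{p,q}x\le x$). **Theorem.** Let $p\ge 1$ and $q$ be integers and let $x^-,x^+\in\mathcal M_{p,q}$ with $x^-<x^+$ be such that there is no $y\in\mathcal M_{p,q}$ with $x^-\ll y\ll x^+$. Then there exist $x\in\mathcal{BM}^+_{q/p}\setminus\mathcal M_{p,q}$ and $\bar x\in\mathcal{BM}^-_{q/p}\setminus\mathcal M_{p,q}$ such that, with respect to pointwise convergence, $$\lim_{n\to\infty}\tau_{p,q}^n x=x^+=\lim_{n\to-\infty}\tau_{p,q}^n\bar x\quad\text{and}\quad\lim_{n\to-\infty}\tau_{p,q}^n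 x=x^-=\lim_{n\to\infty}\tau_{p,q}^n\bar x .$$ -/

import Mathlib

open Filter Topology

namespace AubryMather

/-- The partial derivative of a function of two real variables in the first variable. -/
noncomputable def partialFst (g : ℝ → ℝ → ℝ) : ℝ → ℝ → ℝ :=
  fun a b => deriv (fun t => g t b) a

/-- The partial derivative of a function of two real variables in the second variable. -/
noncomputable def partialSnd (g : ℝ → ℝ → ℝ) : ℝ → ℝ → ℝ :=
  fun a b => deriv (fun t => g a t) b

/-- The requirements on a single pair potential of a local energy of range `r`, apart from the
twist condition: class `C²`, diagonal periodicity, a uniform bound `K / r` on all second partial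
derivatives, and coercivity. -/
structure IsPairPotential (r : ℕ) (K : ℝ) (g : ℝ → ℝ → ℝ) : Prop where
  contDiff : ContDiff ℝ 2 (fun z : ℝ × ℝ => g z.1 z.2)
  periodic : ∀ a b : ℝ, g (a + 1) (b + 1) = g a b
  bound_fst_fst : ∀ a b : ℝ, |partialFst (partialFst g) a b| ≤ K / r
  bound_fst_snd : ∀ a b : ℝ, |partialFst (partialSnd g) a b| ≤ K / r
  bound_snd_fst : ∀ a b : ℝ, |partialSnd (partialFst g) a b| ≤ K / r
  bound_snd_snd : ∀ a b : ℝ, |partialSnd (partialSnd g) a b| ≤ K / r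
  coercive : Tendsto (fun z : ℝ × ℝ => g z.1 z.2)
    (comap (fun z : ℝ × ℝ => |z.1 - z.2|) atTop) atTop

/-- `S : ℝ^{r+1} → ℝ` is a local energy of range `r ≥ 1` with the weak twist condition:
`S(ξ₀, …, ξ_r) = ∑_{j=1}^{r} f_j(ξ₀, ξ_j)` with pair potentials `f_1, …, f_r` as above, whose
mixed derivatives satisfy `∂₁∂₂ f_j ≤ 0` for every `j` and `∂₁∂₂ f_1 ≤ -lam < 0`.
(The mixed derivatives of such an `S` are `∂_0 ∂_j S = ∂₁∂₂ f_j`, and `∂_j ∂_k S = 0` for distinct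
`j, k ≥ 1`, so this is `∂_j ∂_k S ≤ 0` for all `j ≠ k` and `∂_0 ∂_1 S ≤ -lam`.)
The potential `f_j` is `f ⟨j - 1, _⟩` below. -/
def IsLocalEnergy (r : ℕ) (S : (Fin (r + 1) → ℝ) → ℝ) : Prop :=
  1 ≤ r ∧
  ∃ (f : Fin r → ℝ → ℝ → ℝ) (K lam : ℝ), 0 < K ∧ 0 < lam ∧
    (∀ ξ : Fin (r + 1) → ℝ, S ξ = ∑ j : Fin r, f j (ξ 0) (ξ j.succ)) ∧
    (∀ j : Fin r, IsPairPotential r K (f j)) ∧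
    (∀ (j : Fin r) (a b : ℝ), partialFst (partialSnd (f j)) a b ≤ 0) ∧
    (∀ j : Fin r, (j : ℕ) = 0 → ∀ a b : ℝ, partialFst (partialSnd (f j)) a b ≤ -lam)

/-- The translation `(τ_{k,l} x)_i = x_{i-k} + l`, as a bijection of the space of sequences, so
that its iterates `(shift k l) ^ n` make sense for every integer `n`. -/
def shift (k l : ℤ) : Equiv.Perm (ℤ → ℝ) where
  toFun x := fun i => x (i - k) + l
  invFun x := fun i => x (i + k) - l
  left_inv x := by funext i; simp
  right_inv x := by funext i; simp

variable {r : ℕ}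

/-- `S_j(x) = S(x_j, …, x_{j+r})`. -/
def siteEnergy (S : (Fin (r + 1) → ℝ) → ℝ) (j : ℤ) (x : ℤ → ℝ) : ℝ :=
  S (fun k : Fin (r + 1) => x (j + ((k : ℕ) : ℤ)))

/-- `W_B(x) = ∑_{i ∈ B} S_i(x)` for the segment `B = [i₀ - r, i₁]`. -/
noncomputable def segmentAction (S : (Fin (r + 1) → ℝ) → ℝ) (i₀ i₁ : ℤ) (x : ℤ → ℝ) : ℝ :=
  ∑ i ∈ Finset.Icc (i₀ - (r : ℤ)) i₁, siteEnergy S i x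

/-- Global minimizers: `W_B(x) ≤ W_B(x + v)` for every segment `B = [i₀ - r, i₁]`, `i₀ ≤ i₁`, and
every variation `v` supported in its interior `[i₀, i₁]`. -/
def globalMinimizers (S : (Fin (r + 1) → ℝ) → ℝ) : Set (ℤ → ℝ) :=
  {x | ∀ i₀ i₁ : ℤ, i₀ ≤ i₁ → ∀ v : ℤ → ℝ, Function.support v ⊆ Set.Icc i₀ i₁ →
    segmentAction S i₀ i₁ x ≤ segmentAction S i₀ i₁ (x + v)}

/-- The `p`-`q`-periodic sequences: `τ_{p,q} x = x`. -/
def periodicSequences (p q : ℤ) : Set (ℤ → ℝ) :=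
  {x | shift p q x = x}

/-- The periodic action `W_{p,q}(x) = ∑_{i=1}^{p} S_i(x)`. -/
noncomputable def periodicAction (S : (Fin (r + 1) → ℝ) → ℝ) (p : ℤ) (x : ℤ → ℝ) : ℝ :=
  ∑ i ∈ Finset.Icc 1 p, siteEnergy S i x

/-- The `p`-`q`-minimizers (for `p ≥ 1`): the minimizers of the periodic action among the
`p`-`q`-periodic sequences. -/
def periodicMinimizers (S : (Fin (r + 1) → ℝ) → ℝ) (p q : ℤ) : Set (ℤ → ℝ) :=
  {x | x ∈ periodicSequences p q ∧
    ∀ y ∈ periodicSequences p q, periodicAction S p x ≤ periodicAction S p y}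

/-- Birkhoff sequences: ordered with respect to all their translates. -/
def birkhoffSequences : Set (ℤ → ℝ) :=
  {x | ∀ k l : ℤ, shift k l x ≤ x ∨ x ≤ shift k l x}

/-- The sequence `x` has rotation number `ν`: `x_n / n → ν` for `n → ±∞`. -/
def HasRotationNumber (x : ℤ → ℝ) (ν : ℝ) : Prop :=
  Tendsto (fun n : ℤ => x n / (n : ℝ)) atTop (𝓝 ν) ∧
  Tendsto (fun n : ℤ => x n / (n : ℝ)) atBot (𝓝 ν)

/-- Birkhoff global minimizers of rotation number `ν`. -/
def birkhoffMinimizers (S : (Fin (r + 1) → ℝ) → ℝ) (ν : ℝ) : Set (ℤ → ℝ) :=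
  {x | x ∈ globalMinimizers S ∧ x ∈ birkhoffSequences ∧ HasRotationNumber x ν}

/-- Birkhoff global minimizers of rotation number `q / p` with `τ_{p,q} x ≥ x`. -/
def birkhoffMinimizersPlus (S : (Fin (r + 1) → ℝ) → ℝ) (p q : ℤ) : Set (ℤ → ℝ) :=
  {x | x ∈ birkhoffMinimizers S ((q : ℝ) / (p : ℝ)) ∧ x ≤ shift p q x}

/-- Birkhoff global minimizers of rotation number `q / p` with `τ_{p,q} x ≤ x`. -/
def birkhoffMinimizersMinus (S : (Fin (r + 1) → ℝ) → ℝ) (p q : ℤ) : Set (ℤ → ℝ) :=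
  {x | x ∈ birkhoffMinimizers S ((q : ℝ) / (p : ℝ)) ∧ shift p q x ≤ x}

end AubryMather

open AubryMather

/-! The heteroclinic is obtained by minimizing the action among sequences that agree with U = `xp`
far to the left and with u = `xm` far to the right. Two consequences of the twist condition carry
everything. Submodularity: replacing x, y by x ⊓ y, x ⊔ y does not raise the total action. Strong
comparison (`eq_of_touching`): ordered global minimizers that touch coincide.

Periodic minimizers are global minimizers, and so form a chain. The action relative to the step
`glue U u` is bounded below on transitions, because cutting a transition at 0 yields finite
variations of the minimizers u and U, up to finitely many bounded terms. Moving the step by a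
translation that fixes u and U then costs nothing (`relAction_shift_glue`), so a minimizing sequence
can be translated until it crosses a level c strictly between u 0 and U 0 at site 0. This prevents
the limit z from degenerating to u or U (`exists_transition`).

By submodularity the infimum of a minimizing sequence and its translate is again minimizing, which
makes z comparable with its translates by translations fixing u and U. All other translations move
the gap [u, U] off itself, up to shared boundaries (`birkhoff_of_gap`). Hence z is Birkhoff with z ≤
τz; its orbit is monotone, and its limits are periodic minimizers in [u, U], that is, u and U. The
decreasing heteroclinic comes from the reflection x ↦ -x. -/

namespace AubryMather

variable {r : ℕ}

/-- The properties of a local energy on which the variational arguments rest: regularity,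
periodicity, boundedness from below and a quantitative form of submodularity. -/
structure IsTwistEnergy (S : (Fin (r + 1) → ℝ) → ℝ) : Prop where
  one_le : 1 ≤ r
  differentiable : Differentiable ℝ S
  add_one : ∀ ξ : Fin (r + 1) → ℝ, S (fun k => ξ k + 1) = S ξ
  bddBelow : ∃ B, ∀ ξ, B ≤ S ξ
  twist : ∃ lam > 0, ∀ (ξ η : Fin (r + 1) → ℝ) (k : Fin (r + 1)), (k : ℕ) = 1 →
    S (ξ ⊓ η) + S (ξ ⊔ η) + lam * (max (ξ 0 - η 0) 0 * max (η k - ξ k) 0 +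
      max (η 0 - ξ 0) 0 * max (ξ k - η k) 0) ≤ S ξ + S η

/-! ### Pair potentials: submodularity and lower bounds -/

section PairPotential

variable {g : ℝ → ℝ → ℝ}

theorem partialSnd_eq_fderiv (hg : ContDiff ℝ 2 (fun z : ℝ × ℝ => g z.1 z.2)) (a b : ℝ) :
    HasDerivAt (fun t => g a t) (fderiv ℝ (fun z : ℝ × ℝ => g z.1 z.2) (a, b) (0, 1)) b := by
  have h := (hg.differentiable (by norm_num) (a, b)).hasFDerivAt
  exact h.comp_hasDerivAt b ((hasDerivAt_const b a).prodMk (hasDerivAt_id b))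

theorem differentiable_partialSnd (hg : ContDiff ℝ 2 (fun z : ℝ × ℝ => g z.1 z.2)) (b : ℝ) :
    Differentiable ℝ (fun a => partialSnd g a b) := by
  have h1 : ContDiff ℝ 1 (fderiv ℝ (fun z : ℝ × ℝ => g z.1 z.2)) :=
    hg.fderiv_right (by norm_num)
  have h2 := h1.differentiable (by norm_num)
  have h3 : (fun a => partialSnd g a b) =
      fun a => fderiv ℝ (fun z : ℝ × ℝ => g z.1 z.2) (a, b) (0, 1) := by
    funext a
    exact (partialSnd_eq_fderiv hg a b).deriv
  rw [h3]
  fun_prop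

/-- The bound on the mixed derivative is integrated over the rectangle by using the mean value
inequality once in each variable. -/
theorem mixed_difference_le (hg : ContDiff ℝ 2 (fun z : ℝ × ℝ => g z.1 z.2)) {lam : ℝ}
    (hlam : ∀ a b, partialFst (partialSnd g) a b ≤ -lam) {a a' b b' : ℝ} (ha : a ≤ a')
    (hb : b ≤ b') :
    g a' b' + g a b + lam * ((a' - a) * (b' - b)) ≤ g a' b + g a b' := by
  have hd : ∀ a, Differentiable ℝ (fun t => g a t) := fun a t =>
    (partialSnd_eq_fderiv hg a t).differentiableAt
  have h1 : ∀ t, deriv (fun t => g a' t - g a t) t ≤ -lam * (a' - a) := by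
    intro t
    rw [deriv_fun_sub (hd a' t) (hd a t)]
    exact image_sub_le_mul_sub_of_deriv_le (differentiable_partialSnd hg t)
      (fun s => hlam s t) ha
  have h2 := image_sub_le_mul_sub_of_deriv_le ((hd a').sub (hd a)) h1 hb
  simp only [Pi.sub_apply] at h2
  linarith

/-- If the two points are ordered the same way in both coordinates, inf and sup only permute them.
Otherwise all four points are the corners of a rectangle and `mixed_difference_le` applies. -/
theorem pair_submodular (hg : ContDiff ℝ 2 (fun z : ℝ × ℝ => g z.1 z.2)) {lam : ℝ}
    (hlam : ∀ a b, partialFst (partialSnd g) a b ≤ -lam) (a b c d : ℝ) :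
    g (a ⊓ c) (b ⊓ d) + g (a ⊔ c) (b ⊔ d) + lam * (max (a - c) 0 * max (d - b) 0 +
      max (c - a) 0 * max (b - d) 0) ≤ g a b + g c d := by
  rcases le_total a c with h1 | h1 <;> rcases le_total b d with h2 | h2 <;>
    simp only [h1, h2, sub_nonneg.2, sub_nonpos.2, inf_of_le_left, inf_of_le_right,
      sup_of_le_left, sup_of_le_right]
  · linarith
  · have := mixed_difference_le hg hlam h1 h2
    linarith
  · have := mixed_difference_le hg hlam h1 h2
    linarith
  · linarith

theorem periodic_int (hper : ∀ a b : ℝ, g (a + 1) (b + 1) = g a b) (a b : ℝ) (n : ℤ) :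
    g (a + n) (b + n) = g a b := by
  induction n with
  | zero => simp
  | succ n ih =>
    rw [← ih, ← hper (a + (n : ℤ))]
    push_cast
    congr 1 <;> ring
  | pred n ih =>
    rw [← ih, ← hper (a + ((-n - 1 : ℤ) : ℝ))]
    push_cast
    congr 1 <;> ring

theorem IsPairPotential.exists_lower_bound {K : ℝ} (hg : IsPairPotential r K g) :
    ∃ B, ∀ a b, B ≤ g a b := by
  have h1 := hg.coercive.eventually (eventually_ge_atTop 0)
  rw [eventually_comap] at h1
  obtain ⟨R, hR⟩ := eventually_atTop.1 h1
  have hcont : Continuous (fun z : ℝ × ℝ => g z.1 z.2) := hg.contDiff.continuous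
  have hcpt : IsCompact (Set.Icc (0 : ℝ) 1 ×ˢ Set.Icc (-R) (R + 1)) :=
    isCompact_Icc.prod isCompact_Icc
  obtain ⟨B, hB⟩ := hcpt.bddBelow_image hcont.continuousOn
  refine ⟨min B 0, fun a b => ?_⟩
  by_cases hab : R ≤ |a - b|
  · exact (min_le_right _ _).trans (hR _ hab (a, b) rfl)
  · rw [not_le, abs_lt] at hab
    -- Subtracting ⌊a⌋ from both arguments moves a point of the strip |a - b| < R into the compact
    -- rectangle.
    have h2 := periodic_int hg.periodic a b (-⌊a⌋)
    rw [← h2]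
    refine (min_le_left _ _).trans (hB ⟨(_, _), ⟨⟨?_, ?_⟩, ⟨?_, ?_⟩⟩, rfl⟩) <;>
      push_cast <;> linarith [Int.floor_le a, Int.lt_floor_add_one a]

end PairPotential

theorem IsLocalEnergy.isTwistEnergy {S : (Fin (r + 1) → ℝ) → ℝ} (hS : IsLocalEnergy r S) :
    IsTwistEnergy S := by
  obtain ⟨hr, f, K, lam, -, hlam, hSf, hf, htw, htw1⟩ := hS
  refine ⟨hr, ?_, ?_, ?_, lam, hlam, ?_⟩
  · have : S = fun ξ => ∑ j : Fin r, f j (ξ 0) (ξ j.succ) := funext hSf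
    rw [this]
    refine Differentiable.fun_sum fun j _ => ?_
    have h1 := (hf j).contDiff.differentiable (by norm_num)
    have h2 : Differentiable ℝ (fun ξ : Fin (r + 1) → ℝ => (ξ 0, ξ j.succ)) := by fun_prop
    exact h1.comp h2
  · intro ξ
    rw [hSf, hSf]
    exact Finset.sum_congr rfl fun j _ => (hf j).periodic _ _
  · choose B hB using fun j => (hf j).exists_lower_bound
    refine ⟨∑ j, B j, fun ξ => ?_⟩
    rw [hSf]
    exact Finset.sum_le_sum fun j _ => hB j _ _
  · intro ξ η k hk
    have hk' : k = (⟨0, hr⟩ : Fin r).succ := Fin.ext (by simp [hk])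
    subst hk'
    set c := lam * (max (ξ 0 - η 0) 0 * max (η (⟨0, hr⟩ : Fin r).succ -
      ξ (⟨0, hr⟩ : Fin r).succ) 0 + max (η 0 - ξ 0) 0 * max (ξ (⟨0, hr⟩ : Fin r).succ -
      η (⟨0, hr⟩ : Fin r).succ) 0) with hc
    -- The twist surplus is written as a sum with one nonzero term, so that the potentials can be
    -- compared one by one: the first with constant `lam`, the others with constant 0.
    have hsum : ∑ j : Fin r, (if j = ⟨0, hr⟩ then c else 0) = c := by simp
    rw [hSf, hSf, hSf, hSf, ← hsum, ← Finset.sum_add_distrib, ← Finset.sum_add_distrib,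
      ← Finset.sum_add_distrib]
    refine Finset.sum_le_sum fun j _ => ?_
    by_cases hj : j = ⟨0, hr⟩
    · subst hj
      simp only [if_true]
      exact pair_submodular (hf _).contDiff (htw1 _ rfl) _ _ _ _
    · simp only [hj, if_false]
      have := pair_submodular (lam := 0) (hf j).contDiff (by simpa using htw j) (ξ 0)
        (ξ j.succ) (η 0) (η j.succ)
      rw [zero_mul] at this
      exact this

namespace IsTwistEnergy

variable {S : (Fin (r + 1) → ℝ) → ℝ}

theorem add_int (hS : IsTwistEnergy S) (ξ : Fin (r + 1) → ℝ) (n : ℤ) :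
    S (fun k => ξ k + n) = S ξ := by
  induction n with
  | zero => simp
  | succ n ih =>
    rw [← ih, ← hS.add_one (fun k => ξ k + (n : ℤ))]
    push_cast
    simp only [add_assoc]
  | pred n ih =>
    rw [← ih, ← hS.add_one (fun k => ξ k + ((-n - 1 : ℤ) : ℝ))]
    push_cast
    simp only [add_assoc, sub_add_cancel]

theorem submodular (hS : IsTwistEnergy S) (ξ η : Fin (r + 1) → ℝ) :
    S (ξ ⊓ η) + S (ξ ⊔ η) ≤ S ξ + S η := by
  obtain ⟨lam, hlam, h⟩ := hS.twist
  have h1 := h ξ η ⟨1, by have := hS.one_le; omega⟩ rfl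
  refine le_trans (le_add_of_nonneg_right ?_) h1
  positivity

/-- Reflection exchanges inf and sup. It turns increasing heteroclinics into decreasing ones, so
only one kind has to be constructed. -/
theorem comp_neg (hS : IsTwistEnergy S) : IsTwistEnergy (fun ξ => S (-ξ)) := by
  obtain ⟨lam, hlam, h⟩ := hS.twist
  refine ⟨hS.one_le, hS.differentiable.comp (by fun_prop), fun ξ => ?_, ?_, lam, hlam,
    fun ξ η k hk => ?_⟩
  · have := hS.add_int (-ξ) (-1)
    rw [← this]
    congr 1
    funext k
    simp
    ring
  · obtain ⟨B, hB⟩ := hS.bddBelow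
    exact ⟨B, fun ξ => hB _⟩
  · have := h (-ξ) (-η) k hk
    simp only [neg_inf, neg_sup, Pi.neg_apply] at this ⊢
    ring_nf at this ⊢
    linarith

end IsTwistEnergy

variable {S : (Fin (r + 1) → ℝ) → ℝ}

/-! ### Translations -/

section Shift

@[simp]
theorem shift_apply (k l : ℤ) (x : ℤ → ℝ) (i : ℤ) : shift k l x i = x (i - k) + l := rfl

theorem shift_mul (k l k' l' : ℤ) : shift k l * shift k' l' = shift (k + k') (l + l') := by
  ext x i
  simp only [Equiv.Perm.mul_apply, shift_apply]
  push_cast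
  rw [add_comm (l : ℝ), add_assoc, sub_sub]

theorem shift_zero : shift 0 0 = 1 := by
  ext x i
  simp

theorem shift_inv (k l : ℤ) : (shift k l)⁻¹ = shift (-k) (-l) := by
  rw [inv_eq_iff_mul_eq_one, shift_mul, add_neg_cancel, add_neg_cancel, shift_zero]

theorem shift_zpow (k l n : ℤ) : shift k l ^ n = shift (n * k) (n * l) := by
  induction n with
  | zero => simp [shift_zero]
  | succ n ih =>
    rw [zpow_add_one, ih, shift_mul, add_one_mul, add_one_mul]
  | pred n ih =>
    rw [zpow_sub_one, ih, shift_inv, shift_mul, sub_one_mul, sub_one_mul, sub_eq_add_neg,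
      sub_eq_add_neg]

theorem shift_comm (k l k' l' : ℤ) (x : ℤ → ℝ) :
    shift k l (shift k' l' x) = shift k' l' (shift k l x) := by
  rw [← Equiv.Perm.mul_apply, ← Equiv.Perm.mul_apply, shift_mul, shift_mul, add_comm k,
    add_comm l]

theorem shift_shift_neg (k l : ℤ) (x : ℤ → ℝ) : shift k l (shift (-k) (-l) x) = x := by
  rw [← Equiv.Perm.mul_apply, shift_mul, add_neg_cancel, add_neg_cancel, shift_zero]
  rfl

theorem shift_neg_shift (k l : ℤ) (x : ℤ → ℝ) : shift (-k) (-l) (shift k l x) = x := by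
  rw [← Equiv.Perm.mul_apply, shift_mul, neg_add_cancel, neg_add_cancel, shift_zero]
  rfl

theorem shift_monotone (k l : ℤ) : Monotone (shift k l) :=
  fun _ _ h i => add_le_add_left (h (i - k)) _

theorem shift_sup (k l : ℤ) (x y : ℤ → ℝ) :
    shift k l (x ⊔ y) = shift k l x ⊔ shift k l y := by
  funext i
  exact max_add_add_right _ _ _ |>.symm

theorem shift_inf (k l : ℤ) (x y : ℤ → ℝ) :
    shift k l (x ⊓ y) = shift k l x ⊓ shift k l y := by
  funext i
  exact min_add_add_right _ _ _ |>.symm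

theorem continuous_shift (k l : ℤ) : Continuous (shift k l) := by
  refine continuous_pi fun i => ?_
  simp only [shift_apply]
  fun_prop

theorem shift_eventuallyEq (k l : ℤ) {x y : ℤ → ℝ} (h : x =ᶠ[cofinite] y) :
    shift k l x =ᶠ[cofinite] shift k l y := by
  have h1 : Tendsto (fun i : ℤ => i - k) cofinite cofinite :=
    (sub_left_injective (b := k)).tendsto_cofinite
  filter_upwards [h1.eventually h] with i hi
  simp [hi]

theorem siteEnergy_shift (hS : IsTwistEnergy S) (k l i : ℤ) (x : ℤ → ℝ) :
    siteEnergy S i (shift k l x) = siteEnergy S (i - k) x := by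
  rw [siteEnergy, siteEnergy, ← hS.add_int (fun j => x (i - k + ((j : ℕ) : ℤ))) l]
  congr 1
  funext j
  rw [shift_apply]
  congr 2
  ring

end Shift

/-! ### Site energies, relative action and global minimizers -/

theorem siteEnergy_congr {i : ℤ} {x y : ℤ → ℝ} (h : ∀ j, i ≤ j → j ≤ i + r → x j = y j) :
    siteEnergy S i x = siteEnergy S i y := by
  unfold siteEnergy
  congr 1
  funext k
  exact h _ (by omega) (by omega)

theorem continuous_siteEnergy (hS : IsTwistEnergy S) (i : ℤ) : Continuous (siteEnergy S i) :=
  hS.differentiable.continuous.comp (continuous_pi fun _ => continuous_apply _)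

theorem siteEnergy_submodular (hS : IsTwistEnergy S) (i : ℤ) (x y : ℤ → ℝ) :
    siteEnergy S i (x ⊓ y) + siteEnergy S i (x ⊔ y) ≤ siteEnergy S i x + siteEnergy S i y :=
  hS.submodular _ _

theorem siteEnergy_eventuallyEq {x y : ℤ → ℝ} (h : x =ᶠ[cofinite] y) :
    (fun i => siteEnergy S i x) =ᶠ[cofinite] fun i => siteEnergy S i y := by
  have h1 : ∀ k : Fin (r + 1), ∀ᶠ i : ℤ in cofinite,
      x (i + ((k : ℕ) : ℤ)) = y (i + ((k : ℕ) : ℤ)) := fun k =>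
    (add_left_injective ((k : ℕ) : ℤ)).tendsto_cofinite.eventually h
  filter_upwards [eventually_all.2 h1] with i hi
  simp only [siteEnergy, hi]

/-- The action of `y` relative to that of `x`, for sequences that differ at finitely many
places. -/
noncomputable def relAction (S : (Fin (r + 1) → ℝ) → ℝ) (x y : ℤ → ℝ) : ℝ :=
  ∑ᶠ i : ℤ, (siteEnergy S i y - siteEnergy S i x)

theorem finite_support_sub {x y : ℤ → ℝ} (h : x =ᶠ[cofinite] y) :
    (Function.support fun i => siteEnergy S i y - siteEnergy S i x).Finite := by
  have h1 := siteEnergy_eventuallyEq (S := S) h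
  refine Set.Finite.subset (eventually_cofinite.1 h1) fun i hi => ?_
  simp only [Function.mem_support, sub_ne_zero] at hi
  exact fun h2 => hi h2.symm

theorem relAction_add {x y z : ℤ → ℝ} (h : x =ᶠ[cofinite] y) (h' : y =ᶠ[cofinite] z) :
    relAction S x y + relAction S y z = relAction S x z := by
  unfold relAction
  rw [← finsum_add_distrib (finite_support_sub h) (finite_support_sub h')]
  exact finsum_congr fun i => by ring

theorem relAction_self (x : ℤ → ℝ) : relAction S x x = 0 := by
  simp [relAction]

theorem relAction_shift (hS : IsTwistEnergy S) (k l : ℤ) (x y : ℤ → ℝ) :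
    relAction S (shift k l x) (shift k l y) = relAction S x y := by
  unfold relAction
  simp only [siteEnergy_shift hS]
  exact finsum_comp_equiv (Equiv.subRight k)
    (f := fun i => siteEnergy S i y - siteEnergy S i x)

theorem relAction_submodular (hS : IsTwistEnergy S) {x y : ℤ → ℝ}
    (h : x =ᶠ[cofinite] x ⊔ y) :
    relAction S x (x ⊔ y) + relAction S y (x ⊓ y) ≤ 0 := by
  have h' : y =ᶠ[cofinite] x ⊓ y := by
    filter_upwards [h] with i hi
    rw [Pi.sup_apply, left_eq_sup] at hi
    rw [Pi.inf_apply, inf_of_le_right hi]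
  unfold relAction
  rw [← finsum_add_distrib (finite_support_sub h) (finite_support_sub h')]
  have h0 : ∀ i, 0 ≤ -(siteEnergy S i (x ⊔ y) - siteEnergy S i x +
      (siteEnergy S i (x ⊓ y) - siteEnergy S i y)) := fun i => by
    linarith [siteEnergy_submodular hS i x y]
  have := finsum_nonneg h0
  rw [finsum_neg_distrib] at this
  linarith

/-- With range r, a variation in [i₀, i₁] affects only the sites in [i₀ - r, i₁]. -/
theorem relAction_add_eq_segmentAction {i₀ i₁ : ℤ} {v : ℤ → ℝ}
    (hv : Function.support v ⊆ Set.Icc i₀ i₁) (x : ℤ → ℝ) :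
    relAction S x (x + v) = segmentAction S i₀ i₁ (x + v) - segmentAction S i₀ i₁ x := by
  unfold relAction segmentAction
  rw [finsum_eq_sum_of_support_subset (s := Finset.Icc (i₀ - (r : ℤ)) i₁),
    Finset.sum_sub_distrib]
  intro i hi
  rw [Function.mem_support, sub_ne_zero] at hi
  by_contra hi'
  rw [Finset.coe_Icc, Set.mem_Icc, not_and_or, not_le, not_le] at hi'
  refine hi (siteEnergy_congr fun j hj1 hj2 => ?_)
  have : v j = 0 := by
    by_contra h
    have := hv h
    rw [Set.mem_Icc] at this
    omega
  simp [this]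

theorem exists_support_subset_Icc {x y : ℤ → ℝ} (h : x =ᶠ[cofinite] y) :
    ∃ i₀ i₁ : ℤ, i₀ ≤ i₁ ∧ Function.support (y - x) ⊆ Set.Icc i₀ i₁ := by
  have hfin : (Function.support (y - x) ∪ {0}).Finite := by
    refine Set.Finite.union (Set.Finite.subset (eventually_cofinite.1 h) fun i hi => ?_)
      (Set.finite_singleton 0)
    rw [Function.mem_support, Pi.sub_apply, sub_ne_zero] at hi
    exact fun h2 => hi h2.symm
  obtain ⟨i₀, h0⟩ := hfin.bddBelow
  obtain ⟨i₁, h1⟩ := hfin.bddAbove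
  exact ⟨i₀, i₁, (h0 (Or.inr rfl)).trans (h1 (Or.inr rfl)),
    fun i hi => ⟨h0 (Or.inl hi), h1 (Or.inl hi)⟩⟩

theorem mem_globalMinimizers_iff {x : ℤ → ℝ} :
    x ∈ globalMinimizers S ↔ ∀ y, x =ᶠ[cofinite] y → 0 ≤ relAction S x y := by
  constructor
  · intro hx y hy
    obtain ⟨i₀, i₁, h, hv⟩ := exists_support_subset_Icc hy
    have h1 := relAction_add_eq_segmentAction (S := S) hv x
    rw [add_sub_cancel] at h1
    have h2 := hx i₀ i₁ h _ hv
    rw [add_sub_cancel] at h2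
    linarith
  · intro hx i₀ i₁ _ v hv
    have h1 := relAction_add_eq_segmentAction (S := S) hv x
    have h2 : x =ᶠ[cofinite] x + v := by
      refine eventually_cofinite.2 ((Set.finite_Icc i₀ i₁).subset (Set.Subset.trans ?_ hv))
      intro i hi
      simpa using hi
    linarith [hx _ h2]

theorem continuous_relAction_add (hS : IsTwistEnergy S) {v : ℤ → ℝ} {i₀ i₁ : ℤ}
    (hv : Function.support v ⊆ Set.Icc i₀ i₁) :
    Continuous fun x => relAction S x (x + v) := by
  simp only [relAction_add_eq_segmentAction hv]
  unfold segmentAction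
  refine Continuous.sub ?_ ?_ <;> refine continuous_finsetSum _ fun i _ => ?_
  · exact (continuous_siteEnergy hS i).comp (by fun_prop)
  · exact continuous_siteEnergy hS i

theorem shift_mem_globalMinimizers (hS : IsTwistEnergy S) (k l : ℤ) {x : ℤ → ℝ}
    (hx : x ∈ globalMinimizers S) : shift k l x ∈ globalMinimizers S := by
  rw [mem_globalMinimizers_iff] at hx ⊢
  intro y hy
  have h1 := shift_eventuallyEq (-k) (-l) hy
  rw [shift_neg_shift] at h1
  have h2 := hx _ h1
  rwa [← relAction_shift hS k l, shift_shift_neg] at h2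

/-- Pointwise limits of sequences that minimize up to errors tending to `0` are global
minimizers. -/
theorem mem_globalMinimizers_of_tendsto (hS : IsTwistEnergy S) {ι : Type*} {F : Filter ι}
    [F.NeBot] {x : ι → ℤ → ℝ} {z : ℤ → ℝ} {ε : ι → ℝ} (hε : Tendsto ε F (𝓝 0))
    (hx : ∀ n y, x n =ᶠ[cofinite] y → ε n ≤ relAction S (x n) y) (hz : Tendsto x F (𝓝 z)) :
    z ∈ globalMinimizers S := by
  rw [mem_globalMinimizers_iff]
  intro y hy
  obtain ⟨i₀, i₁, -, hv⟩ := exists_support_subset_Icc hy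
  have h1 := ((continuous_relAction_add hS hv).tendsto z).comp hz
  rw [add_sub_cancel] at h1
  refine le_of_tendsto_of_tendsto' hε h1 fun n => hx n _ ?_
  filter_upwards [hy] with i hi
  simp [hi]

theorem isClosed_globalMinimizers (hS : IsTwistEnergy S) {ι : Type*} {F : Filter ι}
    [F.NeBot] {x : ι → ℤ → ℝ} {z : ℤ → ℝ} (hx : ∀ n, x n ∈ globalMinimizers S)
    (hz : Tendsto x F (𝓝 z)) : z ∈ globalMinimizers S :=
  mem_globalMinimizers_of_tendsto hS (ε := fun _ => 0) tendsto_const_nhds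
    (fun n => mem_globalMinimizers_iff.1 (hx n)) hz

/-- The complementary change from y to x ⊓ y cannot lower the action of the minimizer y, so
submodularity forces the change from x to x ⊔ y not to raise it. -/
theorem relAction_sup_nonpos (hS : IsTwistEnergy S) {x y : ℤ → ℝ}
    (hy : y ∈ globalMinimizers S) (h : x =ᶠ[cofinite] x ⊔ y) :
    relAction S x (x ⊔ y) ≤ 0 := by
  have h' : y =ᶠ[cofinite] x ⊓ y := by
    filter_upwards [h] with i hi
    rw [Pi.sup_apply, left_eq_sup] at hi
    rw [Pi.inf_apply, inf_of_le_right hi]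
  linarith [mem_globalMinimizers_iff.1 hy _ h', relAction_submodular hS h]

theorem relAction_inf_nonpos (hS : IsTwistEnergy S) {x y : ℤ → ℝ}
    (hy : y ∈ globalMinimizers S) (h : x =ᶠ[cofinite] x ⊓ y) :
    relAction S x (x ⊓ y) ≤ 0 := by
  have h' : y =ᶠ[cofinite] y ⊔ x := by
    filter_upwards [h] with i hi
    rw [Pi.inf_apply, left_eq_inf] at hi
    rw [Pi.sup_apply, sup_of_le_left hi]
  have := relAction_submodular hS h'
  rw [inf_comm] at this
  linarith [mem_globalMinimizers_iff.1 hy _ h']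

/-! ### Strong comparison principle -/

section Comparison

/-- Raising x at the touching site i by t gives a sequence whose inf with y is x and whose sup with
y is y raised by t. The surplus in submodularity comes from the two nearest-neighbour bonds at i. -/
theorem segmentAction_twist (hS : IsTwistEnergy S) :
    ∃ lam > 0, ∀ (i : ℤ) (x y : ℤ → ℝ), x ≤ y → x i = y i → ∀ t : ℝ, 0 ≤ t →
      segmentAction S i i x + segmentAction S i i (y + Pi.single i t) +
        (lam * (t * (y (i + 1) - x (i + 1))) + lam * (t * (y (i - 1) - x (i - 1)))) ≤
      segmentAction S i i (x + Pi.single i t) + segmentAction S i i y := by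
  obtain ⟨lam, hlam, htw⟩ := hS.twist
  have hr := hS.one_le
  refine ⟨lam, hlam, fun i x y hxy hi t ht => ?_⟩
  set a := x + Pi.single i t with ha
  have hai : a i = x i + t := by simp [ha]
  have haj : ∀ j, j ≠ i → a j = x j := fun j hj => by simp [ha, hj]
  have hinf : a ⊓ y = x := by
    funext j
    by_cases hj : j = i
    · subst hj
      rw [Pi.inf_apply, hai, ← hi]
      exact inf_of_le_right (by linarith)
    · rw [Pi.inf_apply, haj j hj]
      exact inf_of_le_left (hxy j)
  have hsup : a ⊔ y = y + Pi.single i t := by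
    funext j
    by_cases hj : j = i
    · subst hj
      simp only [Pi.sup_apply, hai, hi, Pi.add_apply, Pi.single_eq_same]
      exact sup_of_le_left (by linarith)
    · simp only [Pi.sup_apply, haj j hj, Pi.add_apply, Pi.single_eq_of_ne hj, add_zero]
      exact sup_of_le_right (hxy j)
  set c₁ := lam * (t * (y (i + 1) - x (i + 1)))
  set c₂ := lam * (t * (y (i - 1) - x (i - 1)))
  -- The bonds (i, i + 1) and (i - 1, i) belong to the site energies i and i - 1; both lie in the
  -- segment because r ≥ 1.
  have h1 : ∑ j ∈ Finset.Icc (i - (r : ℤ)) i, (if j = i then c₁ else 0) = c₁ := by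
    rw [Finset.sum_ite_eq', if_pos (Finset.mem_Icc.2 (by omega))]
  have h2 : ∑ j ∈ Finset.Icc (i - (r : ℤ)) i, (if j = i - 1 then c₂ else 0) = c₂ := by
    rw [Finset.sum_ite_eq', if_pos (Finset.mem_Icc.2 (by omega))]
  rw [← h1, ← h2]
  unfold segmentAction
  simp only [← Finset.sum_add_distrib]
  refine Finset.sum_le_sum fun j _ => ?_
  have hsub := siteEnergy_submodular hS j a y
  rw [hinf, hsup] at hsub
  have hk := htw (fun k : Fin (r + 1) => a (j + ((k : ℕ) : ℤ)))
    (fun k : Fin (r + 1) => y (j + ((k : ℕ) : ℤ))) ⟨1, by omega⟩ rfl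
  have e1 : S ((fun k : Fin (r + 1) => a (j + ((k : ℕ) : ℤ))) ⊓
      fun k : Fin (r + 1) => y (j + ((k : ℕ) : ℤ))) = siteEnergy S j (a ⊓ y) := rfl
  have e2 : S ((fun k : Fin (r + 1) => a (j + ((k : ℕ) : ℤ))) ⊔
      fun k : Fin (r + 1) => y (j + ((k : ℕ) : ℤ))) = siteEnergy S j (a ⊔ y) := rfl
  rw [e1, e2, hinf, hsup] at hk
  simp only [Fin.val_zero, Nat.cast_zero, add_zero, Nat.cast_one] at hk
  have e3 : S (fun k : Fin (r + 1) => a (j + ((k : ℕ) : ℤ))) = siteEnergy S j a := rfl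
  have e4 : S (fun k : Fin (r + 1) => y (j + ((k : ℕ) : ℤ))) = siteEnergy S j y := rfl
  rw [e3, e4] at hk
  by_cases hj : j = i
  · subst hj
    have hne : j ≠ j - 1 := by omega
    rw [if_pos rfl, if_neg hne]
    rw [hai, haj (j + 1) (by omega), hi, max_eq_left (by linarith : (0 : ℝ) ≤ y j + t - y j),
      max_eq_left (sub_nonneg.2 (hxy (j + 1))),
      max_eq_right (by linarith : y j - (y j + t) ≤ (0 : ℝ))] at hk
    simp only [add_sub_cancel_left, zero_mul, add_zero] at hk ⊢
    simp only [c₁]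
    linarith
  · by_cases hj' : j = i - 1
    · subst hj'
      rw [if_neg hj, if_pos rfl]
      rw [haj _ hj, sub_add_cancel, hai, hi,
        max_eq_left (by linarith : (0 : ℝ) ≤ y i + t - y i),
        max_eq_left (sub_nonneg.2 (hxy (i - 1))),
        max_eq_right (sub_nonpos.2 (hxy (i - 1)))] at hk
      simp only [add_sub_cancel_left, zero_mul, zero_add, mul_comm _ t] at hk ⊢
      simp only [c₂]
      linarith
    · rw [if_neg hj, if_neg hj']
      linarith

theorem differentiable_segmentAction_single (hS : IsTwistEnergy S) (i₀ i₁ i : ℤ) (x : ℤ → ℝ) :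
    Differentiable ℝ fun t : ℝ => segmentAction S i₀ i₁ (x + Pi.single i t) := by
  unfold segmentAction siteEnergy
  refine Differentiable.fun_sum fun j _ => hS.differentiable.comp ?_
  refine differentiable_pi.2 fun k => ?_
  simp only [Pi.add_apply, Pi.single_apply]
  split_ifs <;> fun_prop

theorem segmentAction_le_single {x : ℤ → ℝ} (hx : x ∈ globalMinimizers S) (i : ℤ) (t : ℝ) :
    segmentAction S i i x ≤ segmentAction S i i (x + Pi.single i t) := by
  refine hx i i le_rfl _ ?_
  rw [Set.Icc_self]
  exact Function.support_subset_iff'.2 fun j hj => Pi.single_eq_of_ne hj _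

/-- Since y is minimizing, `segmentAction_twist` bounds the right difference quotients of G at 0
below by δ, while G'(0) = 0 since x is minimizing. Hence δ ≤ 0, although δ is a sum of nonnegative
terms. -/
theorem eq_neighbours_of_touching (hS : IsTwistEnergy S) {x y : ℤ → ℝ}
    (hx : x ∈ globalMinimizers S) (hy : y ∈ globalMinimizers S) (hxy : x ≤ y) {i : ℤ}
    (hi : x i = y i) : x (i + 1) = y (i + 1) ∧ x (i - 1) = y (i - 1) := by
  obtain ⟨lam, hlam, htw⟩ := segmentAction_twist hS
  set G : ℝ → ℝ := fun t => segmentAction S i i (x + Pi.single i t) with hG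
  have hG0 : G 0 = segmentAction S i i x := by simp [hG]
  have hGd : HasDerivAt G (deriv G 0) 0 :=
    (differentiable_segmentAction_single hS i i i x 0).hasDerivAt
  have hmin : IsLocalMin G 0 := Eventually.of_forall fun t => by
    rw [hG0]
    exact segmentAction_le_single hx i t
  rw [hmin.deriv_eq_zero] at hGd
  have hslope := (hasDerivWithinAt_iff_tendsto_slope' (s := Set.Ioi (0 : ℝ))
    (lt_irrefl (0 : ℝ))).1 hGd.hasDerivWithinAt
  set δ := lam * (y (i + 1) - x (i + 1)) + lam * (y (i - 1) - x (i - 1)) with hδ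
  have hle : δ ≤ 0 := by
    refine ge_of_tendsto hslope ?_
    filter_upwards [self_mem_nhdsWithin] with t ht
    have ht' : (0 : ℝ) < t := ht
    have h1 := htw i x y hxy hi t ht'.le
    have h2 := segmentAction_le_single hy i t
    rw [slope_def_field, le_div_iff₀ (by linarith), hG0]
    simp only [hG, hδ]
    linarith
  have h1 := sub_nonneg.2 (hxy (i + 1))
  have h2 := sub_nonneg.2 (hxy (i - 1))
  have h3 := mul_nonneg hlam.le h1
  have h4 := mul_nonneg hlam.le h2
  constructor
  · have : lam * (y (i + 1) - x (i + 1)) = 0 := by linarith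
    have := (mul_eq_zero.1 this).resolve_left hlam.ne'
    linarith
  · have : lam * (y (i - 1) - x (i - 1)) = 0 := by linarith
    have := (mul_eq_zero.1 this).resolve_left hlam.ne'
    linarith

/-- The strong comparison principle: ordered global minimizers that touch coincide. -/
theorem eq_of_touching (hS : IsTwistEnergy S) {x y : ℤ → ℝ} (hx : x ∈ globalMinimizers S)
    (hy : y ∈ globalMinimizers S) (hxy : x ≤ y) {i : ℤ} (hi : x i = y i) : x = y := by
  funext j
  induction j using Int.inductionOn' with
  | b => exact i
  | zero => exact hi
  | succ k _ ih => exact (eq_neighbours_of_touching hS hx hy hxy ih).1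
  | pred k _ ih => exact (eq_neighbours_of_touching hS hx hy hxy ih).2

theorem strongLT_of_lt (hS : IsTwistEnergy S) {x y : ℤ → ℝ} (hx : x ∈ globalMinimizers S)
    (hy : y ∈ globalMinimizers S) (hxy : x < y) : StrongLT x y := fun i =>
  lt_of_le_of_ne (hxy.le i) fun h => hxy.ne (eq_of_touching hS hx hy hxy.le h)

/-- At site 0 the infimum touches x or y, so strong comparison identifies it with one of them. -/
theorem le_total_of_inf_mem (hS : IsTwistEnergy S) {x y : ℤ → ℝ}
    (hx : x ∈ globalMinimizers S) (hy : y ∈ globalMinimizers S)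
    (hxy : x ⊓ y ∈ globalMinimizers S) : x ≤ y ∨ y ≤ x := by
  rcases min_choice (x 0) (y 0) with h | h
  · exact Or.inl (inf_eq_left.1 (eq_of_touching hS hxy hx inf_le_left (i := 0) h))
  · exact Or.inr (inf_eq_right.1 (eq_of_touching hS hxy hy inf_le_right (i := 0) h))

end Comparison

/-! ### Sums of periodic functions over windows -/

section PeriodicSums

variable {F : ℤ → ℝ} {p : ℤ}

theorem sum_Ico_add_sum_Ico (F : ℤ → ℝ) {a b c : ℤ} (hab : a ≤ b) (hbc : b ≤ c) :
    ∑ i ∈ Finset.Ico a b, F i + ∑ i ∈ Finset.Ico b c, F i = ∑ i ∈ Finset.Ico a c, F i := by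
  rw [← Finset.sum_union (Finset.Ico_disjoint_Ico_consecutive a b c),
    Finset.Ico_union_Ico_eq_Ico hab hbc]

theorem sum_Ico_sub (F : ℤ → ℝ) (a b k : ℤ) :
    ∑ i ∈ Finset.Ico a b, F (i - k) = ∑ i ∈ Finset.Ico (a - k) (b - k), F i := by
  refine Finset.sum_bij (fun i _ => i - k) ?_ ?_ ?_ ?_
  · intro i hi
    rw [Finset.mem_Ico] at hi ⊢
    omega
  · intro i _ j _ h
    exact sub_left_injective h
  · intro i hi
    refine ⟨i + k, ?_, by simp⟩
    rw [Finset.mem_Ico] at hi ⊢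
    omega
  · intro i _
    rfl

theorem sum_Ico_periodic (hF : ∀ i, F (i + p) = F i) (hp : 0 ≤ p) (a b : ℤ) :
    ∑ i ∈ Finset.Ico a (a + p), F i = ∑ i ∈ Finset.Ico b (b + p), F i := by
  have hsing : ∀ c : ℤ, ∑ i ∈ Finset.Ico c (c + 1), F i = F c := fun c => by
    rw [show Finset.Ico c (c + 1) = {c} by ext; simp; omega, Finset.sum_singleton]
  have hstep : ∀ c : ℤ, ∑ i ∈ Finset.Ico (c + 1) (c + 1 + p), F i =
      ∑ i ∈ Finset.Ico c (c + p), F i := fun c => by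
    have h1 := sum_Ico_add_sum_Ico F (show c ≤ c + 1 by omega)
      (show c + 1 ≤ c + 1 + p by omega)
    have h2 := sum_Ico_add_sum_Ico F (show c ≤ c + p by omega)
      (show c + p ≤ c + p + 1 by omega)
    rw [hsing] at h1 h2
    rw [show c + p + 1 = c + 1 + p by ring, hF] at h2
    linarith
  induction a using Int.inductionOn' with
  | b => exact b
  | zero => rfl
  | succ k _ ih => rw [hstep, ih]
  | pred k _ ih => rw [← ih, ← hstep, sub_add_cancel]

theorem sum_Ico_mul_periodic (hF : ∀ i, F (i + p) = F i) (hp : 0 ≤ p) (a : ℤ) (n : ℕ) :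
    ∑ i ∈ Finset.Ico a (a + n * p), F i = n * ∑ i ∈ Finset.Ico a (a + p), F i := by
  induction n with
  | zero => simp
  | succ n ih =>
    have hnp : 0 ≤ (n : ℤ) * p := by positivity
    rw [← sum_Ico_add_sum_Ico F (show a ≤ a + n * p by omega)
      (show a + n * p ≤ a + ((n + 1 : ℕ) : ℤ) * p by push_cast; linarith), ih,
      show a + ((n + 1 : ℕ) : ℤ) * p = a + n * p + p by push_cast; ring,
      sum_Ico_periodic hF hp (a + n * p) a]
    push_cast
    ring

end PeriodicSums

/-! ### Periodic minimizers are global minimizers and form a chain -/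

section PeriodicSequences

variable {p q : ℤ} {x y : ℤ → ℝ}

theorem periodicSequences_apply_sub (hx : x ∈ periodicSequences p q) (i : ℤ) :
    x (i - p) + q = x i := congrFun hx i

theorem siteEnergy_add_period (hS : IsTwistEnergy S) (hx : x ∈ periodicSequences p q) (i : ℤ) :
    siteEnergy S (i + p) x = siteEnergy S i x := by
  have h := siteEnergy_shift hS p q (i + p) x
  rwa [add_sub_cancel_right, show shift p q x = x from hx] at h

theorem periodicAction_eq_sum_Ico (hS : IsTwistEnergy S) (hp : 0 ≤ p)
    (hx : x ∈ periodicSequences p q) (a : ℤ) :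
    periodicAction S p x = ∑ i ∈ Finset.Ico a (a + p), siteEnergy S i x := by
  rw [← sum_Ico_periodic (siteEnergy_add_period hS hx) hp 1 a, periodicAction]
  congr 1
  ext
  simp
  omega

theorem mul_mem_periodicSequences (hx : x ∈ periodicSequences p q) (n : ℕ) :
    x ∈ periodicSequences (n * p) (n * q) := by
  induction n with
  | zero => simp [periodicSequences, shift_zero]
  | succ n ih =>
    have h : shift (n * p) (n * q) (shift p q x) = x := by
      rw [show shift p q x = x from hx]
      exact ih
    rw [← Equiv.Perm.mul_apply, shift_mul] at h
    push_cast
    rw [add_one_mul, add_one_mul]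
    exact h

theorem periodicAction_mul (hS : IsTwistEnergy S) (hp : 0 ≤ p)
    (hx : x ∈ periodicSequences p q) (n : ℕ) :
    periodicAction S (n * p) x = n * periodicAction S p x := by
  rw [periodicAction_eq_sum_Ico hS (by positivity) (mul_mem_periodicSequences hx n) 0,
    periodicAction_eq_sum_Ico hS hp hx 0,
    sum_Ico_mul_periodic (siteEnergy_add_period hS hx) hp]

theorem shift_mem_periodicSequences (hx : x ∈ periodicSequences p q) (k l : ℤ) :
    shift k l x ∈ periodicSequences p q := by
  change shift p q (shift k l x) = shift k l x
  rw [shift_comm, show shift p q x = x from hx]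

theorem sup_mem_periodicSequences (hx : x ∈ periodicSequences p q)
    (hy : y ∈ periodicSequences p q) : x ⊔ y ∈ periodicSequences p q := by
  change shift p q (x ⊔ y) = x ⊔ y
  rw [shift_sup, show shift p q x = x from hx, show shift p q y = y from hy]

theorem inf_mem_periodicSequences (hx : x ∈ periodicSequences p q)
    (hy : y ∈ periodicSequences p q) : x ⊓ y ∈ periodicSequences p q := by
  change shift p q (x ⊓ y) = x ⊓ y
  rw [shift_inf, show shift p q x = x from hx, show shift p q y = y from hy]

theorem periodicAction_shift (hS : IsTwistEnergy S) (hp : 0 ≤ p)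
    (hx : x ∈ periodicSequences p q) (k l : ℤ) :
    periodicAction S p (shift k l x) = periodicAction S p x := by
  rw [periodicAction_eq_sum_Ico hS hp (shift_mem_periodicSequences hx k l) k,
    periodicAction_eq_sum_Ico hS hp hx 0]
  simp only [siteEnergy_shift hS]
  rw [sum_Ico_sub (fun i => siteEnergy S i x)]
  congr 2 <;> ring

theorem periodicAction_submodular (hS : IsTwistEnergy S) (p : ℤ) (x y : ℤ → ℝ) :
    periodicAction S p (x ⊓ y) + periodicAction S p (x ⊔ y) ≤
      periodicAction S p x + periodicAction S p y := by
  unfold periodicAction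
  rw [← Finset.sum_add_distrib, ← Finset.sum_add_distrib]
  exact Finset.sum_le_sum fun i _ => siteEnergy_submodular hS i x y

theorem shift_mem_periodicMinimizers (hS : IsTwistEnergy S) (hp : 0 ≤ p)
    (hx : x ∈ periodicMinimizers S p q) (k l : ℤ) :
    shift k l x ∈ periodicMinimizers S p q :=
  ⟨shift_mem_periodicSequences hx.1 k l, fun y hy => by
    rw [periodicAction_shift hS hp hx.1]
    exact hx.2 y hy⟩

theorem inf_mem_periodicMinimizers (hS : IsTwistEnergy S) (hx : x ∈ periodicMinimizers S p q)
    (hy : y ∈ periodicMinimizers S p q) : x ⊓ y ∈ periodicMinimizers S p q :=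
  ⟨inf_mem_periodicSequences hx.1 hy.1, fun z hz => by
    have h1 := periodicAction_submodular hS p x y
    have h2 := hx.2 _ (sup_mem_periodicSequences hx.1 hy.1)
    have h3 := hy.2 z hz
    linarith⟩

/-- Partial suprema of the translates of a sequence under `τ_{p,q}`. -/
def supTranslates (p q : ℤ) (x : ℤ → ℝ) : ℕ → ℤ → ℝ
  | 0 => x
  | n + 1 => x ⊔ shift p q (supTranslates p q x n)

/-- The recursion applies the translation to the previous supremum; this form adjoins only the top
translate of x, which is x itself once the longer period closes up. -/
theorem supTranslates_succ (p q : ℤ) (x : ℤ → ℝ) (n : ℕ) :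
    supTranslates p q x (n + 1) =
      supTranslates p q x n ⊔ shift ((n + 1 : ℕ) * p) ((n + 1 : ℕ) * q) x := by
  induction n with
  | zero => simp [supTranslates]
  | succ n ih =>
    have h1 : ∀ c : ℤ, c + (n + 1 : ℕ) * c = (n + 1 + 1 : ℕ) * c := fun c => by
      push_cast
      ring
    conv_lhs => rw [supTranslates, ih, shift_sup, ← Equiv.Perm.mul_apply, shift_mul,
      ← sup_assoc, h1, h1]
    rfl

theorem le_supTranslates (p q : ℤ) (x : ℤ → ℝ) (n : ℕ) : x ≤ supTranslates p q x n := by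
  cases n with
  | zero => exact le_rfl
  | succ n => exact le_sup_left

theorem supTranslates_mem_periodicSequences {P Q : ℤ} (hx : x ∈ periodicSequences P Q)
    (n : ℕ) : supTranslates p q x n ∈ periodicSequences P Q := by
  induction n with
  | zero => exact hx
  | succ n ih => exact sup_mem_periodicSequences hx (shift_mem_periodicSequences ih p q)

/-- Write M for the supremum and τ for the translation. Since τⁿ⁺¹x = x, τM ≤ M; iterating, M =
τⁿ⁺¹M ≤ τM. -/
theorem supTranslates_invariant {n : ℕ}
    (hx : x ∈ periodicSequences ((n + 1 : ℕ) * p) ((n + 1 : ℕ) * q)) :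
    supTranslates p q x n ∈ periodicSequences p q := by
  set M := supTranslates p q x n with hM
  have hle : shift p q M ≤ M := by
    have h1 : shift p q M ≤ supTranslates p q x (n + 1) := le_sup_right
    rwa [supTranslates_succ, show shift _ _ x = x from hx,
      sup_of_le_left (le_supTranslates p q x n)] at h1
  have hiter : ∀ k : ℕ, shift (k * p) (k * q) M ≤ M := by
    intro k
    induction k with
    | zero => simp [shift_zero]
    | succ k ih =>
      have h1 := (shift_monotone p q ih).trans hle
      rw [← Equiv.Perm.mul_apply, shift_mul] at h1
      push_cast
      rwa [add_one_mul, add_one_mul, add_comm _ p, add_comm _ q]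
  refine le_antisymm hle ?_
  have h1 : shift ((n + 1 : ℕ) * p) ((n + 1 : ℕ) * q) M = M :=
    supTranslates_mem_periodicSequences hx n
  have h2 := shift_monotone p q (hiter n)
  rw [← Equiv.Perm.mul_apply, shift_mul] at h2
  push_cast at h1
  rwa [add_comm p, add_comm q, ← add_one_mul, ← add_one_mul, h1] at h2

theorem exists_le_periodicAction (hS : IsTwistEnergy S) (p : ℤ) :
    ∃ B, ∀ x, B ≤ periodicAction S p x := by
  obtain ⟨B, hB⟩ := hS.bddBelow
  exact ⟨∑ i ∈ Finset.Icc 1 p, B, fun x => Finset.sum_le_sum fun i _ => hB _⟩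

/-- Minimizers of period `(p, q)` also minimize among sequences of a multiple period. -/
theorem mul_periodicAction_le (hS : IsTwistEnergy S) (hp : 0 ≤ p)
    (hy : y ∈ periodicMinimizers S p q) {n : ℕ} (hn : 0 < n)
    (hx : x ∈ periodicSequences (n * p) (n * q)) :
    n * periodicAction S p y ≤ periodicAction S (n * p) x := by
  obtain ⟨m, rfl⟩ : ∃ m, n = m + 1 := ⟨n - 1, by omega⟩
  set P : ℤ := ((m + 1 : ℕ) : ℤ) * p with hP
  set Q : ℤ := ((m + 1 : ℕ) : ℤ) * q with hQ
  have hP0 : 0 ≤ P := by positivity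
  set E := periodicAction S P '' periodicSequences P Q with hE
  have hbdd : BddBelow E := by
    obtain ⟨B, hB⟩ := exists_le_periodicAction hS P
    refine ⟨B, ?_⟩
    rintro _ ⟨z, -, rfl⟩
    exact hB z
  have hne : E.Nonempty := ⟨_, x, hx, rfl⟩
  have hinf : ∀ z ∈ periodicSequences P Q, sInf E ≤ periodicAction S P z := fun z hz =>
    csInf_le hbdd ⟨z, hz, rfl⟩
  refine le_trans ?_ (hinf x hx)
  refine le_of_forall_pos_le_add fun ε hε => ?_
  -- The infimum over the longer period is not known to be attained, so an almost minimizer w is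
  -- used. Each join with another translate adds at most ε / (m + 1), as the corresponding inf has
  -- action at least the infimum.
  obtain ⟨_, ⟨w, hw, rfl⟩, hwε⟩ := exists_lt_of_csInf_lt hne
    (show sInf E < sInf E + ε / (m + 1 : ℕ) by
      have : 0 < ε / (m + 1 : ℕ) := by positivity
      linarith)
  have hsup : ∀ k : ℕ, periodicAction S P (supTranslates p q w k) ≤
      sInf E + (k + 1 : ℕ) * (ε / (m + 1 : ℕ)) := by
    intro k
    induction k with
    | zero => simpa [supTranslates] using hwε.le
    | succ k ih =>
      have hk := supTranslates_mem_periodicSequences (p := p) (q := q) hw k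
      have hk' := shift_mem_periodicSequences hk p q
      have h1 := periodicAction_submodular hS P w (shift p q (supTranslates p q w k))
      rw [periodicAction_shift hS hP0 hk] at h1
      have h2 := hinf _ (inf_mem_periodicSequences hw hk')
      rw [supTranslates]
      push_cast at ih hwε ⊢
      linarith
  have h1 := hsup m
  rw [mul_div_cancel₀ _ (by positivity)] at h1
  have h2 := supTranslates_invariant hw
  have h3 := hy.2 _ h2
  rw [hP, periodicAction_mul hS hp h2] at h1
  exact (mul_le_mul_of_nonneg_left h3 (by positivity)).trans h1

/-- A finite variation fits into one period of length np for large n. Repeating it periodically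
gives a competitor for `mul_periodicAction_le`. -/
theorem periodicMinimizers_subset_globalMinimizers (hS : IsTwistEnergy S) (hp : 1 ≤ p) :
    periodicMinimizers S p q ⊆ globalMinimizers S := by
  intro x hx
  rw [mem_globalMinimizers_iff]
  intro y hy
  obtain ⟨i₀, i₁, hi, hv⟩ := exists_support_subset_Icc hy
  set v := y - x
  have hvz : ∀ j, j < i₀ ∨ i₁ < j → v j = 0 := fun j hj => by
    by_contra h
    have := hv h
    rw [Set.mem_Icc] at this
    omega
  have hy' : y = x + v := (add_sub_cancel x y).symm
  set a := i₀ - (r : ℤ) with ha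
  set n : ℕ := (i₁ + 1 - a).toNat with hn
  have hn' : (n : ℤ) = i₁ + 1 - a := Int.toNat_of_nonneg (by omega)
  set P : ℤ := n * p with hP
  have hPn : (n : ℤ) ≤ P := le_mul_of_one_le_right (by positivity) hp
  have hv' : Function.support v ⊆ Set.Icc i₀ (a + P - 1) :=
    hv.trans (Set.Icc_subset_Icc le_rfl (by omega))
  set z : ℤ → ℝ := fun i => x i + v (a + (i - a) % P) with hz
  have hxP : x ∈ periodicSequences P (n * q) := mul_mem_periodicSequences hx.1 n
  have hzP : z ∈ periodicSequences P (n * q) := by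
    funext i
    have h1 := periodicSequences_apply_sub hxP i
    have h2 : (i - P - a) % P = (i - a) % P := by
      rw [sub_right_comm, Int.sub_emod_right]
    simp only [shift_apply, hz, h2]
    linarith
  -- The window starts r sites before i₀, so the next copy of v vanishes on the r sites after the
  -- window, and site energies in the window see only one copy.
  have hzy : ∀ j, a ≤ j → j < a + P + r → z j = y j := by
    intro j h1 h2
    rw [hy']
    simp only [hz, Pi.add_apply]
    congr 1
    by_cases h3 : j < a + P
    · rw [Int.emod_eq_of_lt (by omega) (by omega)]
      congr 1
      omega
    · rw [show j - a = (j - a - P) + P by ring, Int.add_emod_right,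
        Int.emod_eq_of_lt (by omega) (by omega), hvz _ (Or.inl (by omega)),
        hvz j (Or.inr (by omega))]
  have hmain := mul_periodicAction_le hS (by omega) hx (n := n) (by omega) hzP
  rw [← periodicAction_mul hS (by omega) hx.1,
    periodicAction_eq_sum_Ico hS (by omega) hxP a,
    periodicAction_eq_sum_Ico hS (by omega) hzP a] at hmain
  have hsum : ∑ i ∈ Finset.Ico a (a + P), siteEnergy S i z =
      ∑ i ∈ Finset.Ico a (a + P), siteEnergy S i y :=
    Finset.sum_congr rfl fun i hi => siteEnergy_congr fun j h1 h2 => by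
      rw [Finset.mem_Ico] at hi
      exact hzy j (by omega) (by omega)
  have hIco : Finset.Icc a (a + P - 1) = Finset.Ico a (a + P) := by
    ext
    simp
  have h := relAction_add_eq_segmentAction (S := S) hv' x
  rw [← hy', segmentAction, segmentAction, ← ha, hIco, ← hsum] at h
  linarith

theorem periodicMinimizers_le_total (hS : IsTwistEnergy S) (hp : 1 ≤ p)
    (hx : x ∈ periodicMinimizers S p q) (hy : y ∈ periodicMinimizers S p q) :
    x ≤ y ∨ y ≤ x := by
  have hsub := periodicMinimizers_subset_globalMinimizers (q := q) hS hp
  exact le_total_of_inf_mem hS (hsub hx) (hsub hy) (hsub (inf_mem_periodicMinimizers hS hx hy))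

end PeriodicSequences

/-! ### Transitions from U to u and their minimization -/

/-- The sequence that agrees with `x` on the negative integers and with `y` elsewhere. -/
def glue (x y : ℤ → ℝ) : ℤ → ℝ := fun i => if i < 0 then x i else y i

theorem glue_of_neg (x y : ℤ → ℝ) {i : ℤ} (h : i < 0) : glue x y i = x i := if_pos h

theorem glue_of_nonneg (x y : ℤ → ℝ) {i : ℤ} (h : 0 ≤ i) : glue x y i = y i :=
  if_neg h.not_gt

theorem le_glue {u x y : ℤ → ℝ} (hx : u ≤ x) (hy : u ≤ y) : u ≤ glue x y := fun i => by
  unfold glue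
  split_ifs
  exacts [hx i, hy i]

theorem glue_le {u x y : ℤ → ℝ} (hx : x ≤ u) (hy : y ≤ u) : glue x y ≤ u := fun i => by
  unfold glue
  split_ifs
  exacts [hx i, hy i]

theorem siteEnergy_glue_of_neg (x y : ℤ → ℝ) {i : ℤ} (h : i < -r) :
    siteEnergy S i (glue x y) = siteEnergy S i x :=
  siteEnergy_congr fun j _ _ => glue_of_neg x y (by omega)

theorem siteEnergy_glue_of_nonneg (x y : ℤ → ℝ) {i : ℤ} (h : 0 ≤ i) :
    siteEnergy S i (glue x y) = siteEnergy S i y :=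
  siteEnergy_congr fun j _ _ => glue_of_nonneg x y (by omega)

theorem exists_siteEnergy_bound (hS : IsTwistEnergy S) (u U : ℤ → ℝ) (i : ℤ) :
    ∃ B, ∀ x, u ≤ x → x ≤ U → |siteEnergy S i x| ≤ B := by
  obtain ⟨B, hB⟩ := (isCompact_Icc (a := u) (b := U)).exists_bound_of_continuousOn
    (continuous_siteEnergy hS i).continuousOn
  exact ⟨B, fun x h1 h2 => hB x ⟨h1, h2⟩⟩

theorem glue_eventuallyEq_left {x u U : ℤ → ℝ} (h : glue U u =ᶠ[cofinite] x) :
    u =ᶠ[cofinite] glue u x := by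
  filter_upwards [h] with i hi
  unfold glue at hi ⊢
  split_ifs at hi ⊢
  exacts [rfl, hi]

theorem glue_eventuallyEq_right {x u U : ℤ → ℝ} (h : glue U u =ᶠ[cofinite] x) :
    U =ᶠ[cofinite] glue x U := by
  filter_upwards [h] with i hi
  unfold glue at hi ⊢
  split_ifs at hi ⊢
  exacts [hi, rfl]

section Transition

variable {u U : ℤ → ℝ}

/-- Cut x at 0: its right half continued by u, and its left half continued by U, are finite
variations of u and U with nonnegative relative action. The error sits on the r sites whose energies
straddle the cut. -/
theorem exists_le_relAction_of_mem_Icc (hS : IsTwistEnergy S) (hu : u ∈ globalMinimizers S)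
    (hU : U ∈ globalMinimizers S) (huU : u ≤ U) :
    ∃ C, ∀ x, glue U u =ᶠ[cofinite] x → u ≤ x → x ≤ U → C ≤ relAction S (glue U u) x := by
  choose B hB using exists_siteEnergy_bound hS u U
  -- Six site energies enter the error at site i, each at most `B i` in absolute value.
  refine ⟨∑ i ∈ Finset.Ico (-(r : ℤ)) 0, -(6 * B i), fun x hx h1 h2 => ?_⟩
  have hl : u =ᶠ[cofinite] glue u x := glue_eventuallyEq_left hx
  have hr := glue_eventuallyEq_right hx
  have hl0 := mem_globalMinimizers_iff.1 hu _ hl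
  have hr0 := mem_globalMinimizers_iff.1 hU _ hr
  have key : relAction S (glue U u) x - relAction S u (glue u x) - relAction S U (glue x U) =
      ∑ i ∈ Finset.Ico (-(r : ℤ)) 0, (siteEnergy S i x - siteEnergy S i (glue U u) -
        (siteEnergy S i (glue u x) - siteEnergy S i u) -
        (siteEnergy S i (glue x U) - siteEnergy S i U)) := by
    unfold relAction
    rw [← finsum_sub_distrib (finite_support_sub hx) (finite_support_sub hl),
      ← finsum_sub_distrib _ (finite_support_sub hr)]
    · refine finsum_eq_sum_of_support_subset _ fun i hi => ?_
      rw [Finset.coe_Ico, Set.mem_Ico]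
      by_contra hi'
      rw [not_and_or, not_le, not_lt] at hi'
      refine hi ?_
      rcases hi' with hi' | hi'
      · simp only [siteEnergy_glue_of_neg _ _ hi']
        ring
      · simp only [siteEnergy_glue_of_nonneg _ _ hi']
        ring
    · exact ((finite_support_sub hx).union (finite_support_sub hl)).subset
        (Function.support_sub _ _)
  have hge : ∑ i ∈ Finset.Ico (-(r : ℤ)) 0, -(6 * B i) ≤ _ := Finset.sum_le_sum
    (g := fun i => siteEnergy S i x - siteEnergy S i (glue U u) -
        (siteEnergy S i (glue u x) - siteEnergy S i u) -
        (siteEnergy S i (glue x U) - siteEnergy S i U)) fun i _ => by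
    have b1 := abs_le.1 (hB i x h1 h2)
    have b2 := abs_le.1 (hB i _ (le_glue huU le_rfl) (glue_le le_rfl huU))
    have b3 := abs_le.1 (hB i _ (le_glue le_rfl h1) (glue_le huU h2))
    have b4 := abs_le.1 (hB i u le_rfl huU)
    have b5 := abs_le.1 (hB i _ (le_glue h1 huU) (glue_le h2 le_rfl))
    have b6 := abs_le.1 (hB i U huU le_rfl)
    linarith
  linarith

theorem exists_clamp (hS : IsTwistEnergy S) (hu : u ∈ globalMinimizers S)
    (hU : U ∈ globalMinimizers S) (huU : u ≤ U) {x : ℤ → ℝ}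
    (hx : glue U u =ᶠ[cofinite] x) :
    ∃ y, glue U u =ᶠ[cofinite] y ∧ u ≤ y ∧ y ≤ U ∧
      relAction S (glue U u) y ≤ relAction S (glue U u) x := by
  have h1 : glue U u ⊔ u = glue U u := sup_of_le_left (le_glue huU le_rfl)
  have h2 : glue U u ⊓ U = glue U u := inf_of_le_left (glue_le le_rfl huU)
  have h3 : glue U u =ᶠ[cofinite] x ⊔ u := by
    have := hx.sup (EventuallyEq.refl _ u)
    rwa [h1] at this
  have h4 : glue U u =ᶠ[cofinite] (x ⊔ u) ⊓ U := by
    have := h3.inf (EventuallyEq.refl _ U)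
    rwa [h2] at this
  refine ⟨(x ⊔ u) ⊓ U, h4, le_inf le_sup_right huU, inf_le_right, ?_⟩
  have h5 := relAction_sup_nonpos hS hu (hx.symm.trans h3)
  have h6 := relAction_inf_nonpos hS hU (h3.symm.trans h4)
  rw [← relAction_add h3 (h3.symm.trans h4), ← relAction_add hx (hx.symm.trans h3)]
  linarith

theorem exists_le_relAction (hS : IsTwistEnergy S) (hu : u ∈ globalMinimizers S)
    (hU : U ∈ globalMinimizers S) (huU : u ≤ U) :
    ∃ C, ∀ x, glue U u =ᶠ[cofinite] x → C ≤ relAction S (glue U u) x := by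
  obtain ⟨C, hC⟩ := exists_le_relAction_of_mem_Icc hS hu hU huU
  refine ⟨C, fun x hx => ?_⟩
  obtain ⟨y, h1, h2, h3, h4⟩ := exists_clamp hS hu hU huU hx
  exact (hC y h1 h2 h3).trans h4

theorem glue_eventuallyEq_shift {k l : ℤ} (hu : shift k l u = u) (hU : shift k l U = U) :
    glue U u =ᶠ[cofinite] shift k l (glue U u) := by
  refine eventually_cofinite.2 ((Set.finite_Icc (-|k|) |k|).subset fun i hi => ?_)
  by_contra hi'
  refine hi ?_
  have hu' := congrFun hu i
  have hU' := congrFun hU i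
  rw [shift_apply] at hu' hU' ⊢
  rw [Set.mem_Icc, not_and_or, not_le, not_le] at hi'
  have := neg_abs_le k
  have := le_abs_self k
  rcases hi' with hi' | hi'
  · rw [glue_of_neg _ _ (by omega), glue_of_neg _ _ (by omega), hU']
  · rw [glue_of_nonneg _ _ (by omega), glue_of_nonneg _ _ (by omega), hu']

/-- The cost of n successive translations is n times the cost of one, and it is bounded below in n.
-/
theorem relAction_shift_glue_nonneg (hS : IsTwistEnergy S) (hu : u ∈ globalMinimizers S)
    (hU : U ∈ globalMinimizers S) (huU : u ≤ U) {k l : ℤ} (hku : shift k l u = u)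
    (hkU : shift k l U = U) : 0 ≤ relAction S (glue U u) (shift k l (glue U u)) := by
  obtain ⟨C, hC⟩ := exists_le_relAction hS hu hU huU
  set h := glue U u
  have h0 : h =ᶠ[cofinite] shift k l h := glue_eventuallyEq_shift hku hkU
  have hiter : ∀ n : ℕ, h =ᶠ[cofinite] (shift k l)^[n] h ∧
      relAction S h ((shift k l)^[n] h) = n * relAction S h (shift k l h) := by
    intro n
    induction n with
    | zero => simp [relAction_self, EventuallyEq.refl]
    | succ n ih =>
      have h1 := shift_eventuallyEq k l ih.1
      rw [Function.iterate_succ_apply']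
      refine ⟨h0.trans h1, ?_⟩
      rw [← relAction_add h0 h1, relAction_shift hS, ih.2]
      push_cast
      ring
  by_contra hneg
  rw [not_le] at hneg
  obtain ⟨n, hn⟩ := exists_nat_gt (C / relAction S h (shift k l h))
  rw [div_lt_iff_of_neg hneg] at hn
  have := hC _ (hiter n).1
  rw [(hiter n).2] at this
  linarith

theorem relAction_shift_glue (hS : IsTwistEnergy S) (hu : u ∈ globalMinimizers S)
    (hU : U ∈ globalMinimizers S) (huU : u ≤ U) {k l : ℤ} (hku : shift k l u = u)
    (hkU : shift k l U = U) : relAction S (glue U u) (shift k l (glue U u)) = 0 := by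
  have hneg : ∀ x, shift k l x = x → shift (-k) (-l) x = x := fun x hx => by
    conv_lhs => rw [← hx, shift_neg_shift]
  have h1 := relAction_shift_glue_nonneg hS hu hU huU hku hkU
  have h2 := relAction_shift_glue_nonneg hS hu hU huU (hneg u hku) (hneg U hkU)
  rw [← relAction_shift hS k l, shift_shift_neg] at h2
  have h0 : glue U u =ᶠ[cofinite] shift k l (glue U u) := glue_eventuallyEq_shift hku hkU
  have h3 := relAction_add (S := S) h0 h0.symm
  rw [relAction_self] at h3
  linarith

/-- A periodic global minimizer above a periodic minimizer is itself a periodic minimizer. -/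
theorem mem_periodicMinimizers_of_mem_globalMinimizers (hS : IsTwistEnergy S) {p q : ℤ}
    (hp : 1 ≤ p) (hu : u ∈ periodicMinimizers S p q) {z : ℤ → ℝ}
    (hz : z ∈ globalMinimizers S) (hzp : z ∈ periodicSequences p q) (huz : u ≤ z) :
    z ∈ periodicMinimizers S p q := by
  have hu' := periodicMinimizers_subset_globalMinimizers hS hp hu
  have h0 := relAction_shift_glue hS hu' hz huz hu.1 hzp
  set h := glue z u with hh
  unfold relAction at h0
  simp only [siteEnergy_shift hS] at h0
  -- After cancellation, the zero cost of moving the step by one period is one period of z minus one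
  -- period of u, so both have the same periodic action.
  rw [finsum_eq_sum_of_support_subset (s := Finset.Ico (-(r : ℤ)) p),
    Finset.sum_sub_distrib, sum_Ico_sub (fun i => siteEnergy S i h), sub_self,
    ← sum_Ico_add_sum_Ico _ (show -(r : ℤ) - p ≤ -r by omega) (show -(r : ℤ) ≤ 0 by omega),
    ← sum_Ico_add_sum_Ico _ (show -(r : ℤ) ≤ 0 by omega) (show 0 ≤ p by omega)] at h0
  · have h1 : ∑ i ∈ Finset.Ico (-(r : ℤ) - p) (-r), siteEnergy S i h =
        periodicAction S p z := by
      rw [periodicAction_eq_sum_Ico hS (by omega) hzp (-(r : ℤ) - p), sub_add_cancel]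
      refine Finset.sum_congr rfl fun i hi => siteEnergy_glue_of_neg _ _ ?_
      exact (Finset.mem_Ico.1 hi).2
    have h2 : ∑ i ∈ Finset.Ico 0 p, siteEnergy S i h = periodicAction S p u := by
      rw [periodicAction_eq_sum_Ico hS (by omega) hu.1 0, zero_add]
      refine Finset.sum_congr rfl fun i hi => siteEnergy_glue_of_nonneg _ _ ?_
      exact (Finset.mem_Ico.1 hi).1
    refine ⟨hzp, fun y hy => ?_⟩
    have := hu.2 y hy
    linarith
  · intro i hi
    rw [Finset.coe_Ico, Set.mem_Ico]
    by_contra hi'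
    rw [not_and_or, not_le, not_lt] at hi'
    refine hi ?_
    rw [sub_eq_zero]
    rcases hi' with hi' | hi'
    · rw [hh, siteEnergy_glue_of_neg _ _ hi', siteEnergy_glue_of_neg _ _ (by omega),
        ← siteEnergy_add_period hS hzp, sub_add_cancel]
    · rw [hh, siteEnergy_glue_of_nonneg _ _ (by omega), siteEnergy_glue_of_nonneg _ _ (by omega),
        ← siteEnergy_add_period hS hu.1, sub_add_cancel]

/-- Clamping keeps the minimizing sequence in the compact order interval [u, U]. -/
theorem exists_minimizing_sequence (hS : IsTwistEnergy S) (hu : u ∈ globalMinimizers S)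
    (hU : U ∈ globalMinimizers S) (huU : u ≤ U) :
    ∃ e : ℝ, (∀ y, glue U u =ᶠ[cofinite] y → e ≤ relAction S (glue U u) y) ∧
      ∃ x : ℕ → ℤ → ℝ, (∀ n, glue U u =ᶠ[cofinite] x n ∧ u ≤ x n ∧ x n ≤ U) ∧
        Tendsto (fun n => relAction S (glue U u) (x n)) atTop (𝓝 e) := by
  set E := relAction S (glue U u) '' {y | glue U u =ᶠ[cofinite] y} with hE
  have hbdd : BddBelow E := by
    obtain ⟨C, hC⟩ := exists_le_relAction hS hu hU huU
    refine ⟨C, ?_⟩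
    rintro _ ⟨y, hy, rfl⟩
    exact hC y hy
  have hne : E.Nonempty := ⟨_, glue U u, EventuallyEq.refl cofinite (glue U u), rfl⟩
  have hle : ∀ y, glue U u =ᶠ[cofinite] y → sInf E ≤ relAction S (glue U u) y :=
    fun y hy => csInf_le hbdd ⟨y, hy, rfl⟩
  refine ⟨sInf E, hle, ?_⟩
  have hex : ∀ n : ℕ, ∃ x, (glue U u =ᶠ[cofinite] x ∧ u ≤ x ∧ x ≤ U) ∧
      relAction S (glue U u) x < sInf E + 1 / ((n : ℝ) + 1) := fun n => by
    obtain ⟨_, ⟨y, hy, rfl⟩, h⟩ := exists_lt_of_csInf_lt hne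
      (lt_add_of_pos_right (sInf E) (Nat.one_div_pos_of_nat (n := n)))
    obtain ⟨x, h1, h2, h3, h4⟩ := exists_clamp hS hu hU huU hy
    exact ⟨x, ⟨h1, h2, h3⟩, h4.trans_lt h⟩
  choose x hx hlt using hex
  refine ⟨x, hx, tendsto_of_tendsto_of_tendsto_of_le_of_le tendsto_const_nhds ?_
    (fun n => hle _ (hx n).1) fun n => (hlt n).le⟩
  simpa using tendsto_const_nhds.add (tendsto_one_div_add_atTop_nhds_zero_nat (𝕜 := ℝ))

theorem mem_globalMinimizers_of_minimizing (hS : IsTwistEnergy S) {h z : ℤ → ℝ} {e : ℝ}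
    (he : ∀ y, h =ᶠ[cofinite] y → e ≤ relAction S h y) {x : ℕ → ℤ → ℝ}
    (hx : ∀ n, h =ᶠ[cofinite] x n) (hlim : Tendsto (fun n => relAction S h (x n)) atTop (𝓝 e))
    (hz : Tendsto x atTop (𝓝 z)) : z ∈ globalMinimizers S := by
  refine mem_globalMinimizers_of_tendsto hS (ε := fun n => e - relAction S h (x n)) ?_ ?_ hz
  · simpa using (tendsto_const_nhds (x := e)).sub hlim
  · intro n y hy
    have h1 := relAction_add (S := S) (hx n) hy
    have h2 := he y ((hx n).trans hy)
    linarith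

end Transition

/-! ### The increasing heteroclinic in a gap -/

variable {p q : ℤ} {u U : ℤ → ℝ}

theorem zpow_shift_eq_self {x : ℤ → ℝ} (hx : x ∈ periodicSequences p q) (n : ℤ) :
    (shift p q ^ n) x = x :=
  Equiv.Perm.zpow_apply_eq_self_of_apply_eq_self hx n

theorem zpow_shift_mem_Icc (hu : u ∈ periodicSequences p q) (hU : U ∈ periodicSequences p q)
    {x : ℤ → ℝ} (hux : u ≤ x) (hxU : x ≤ U) (n : ℤ) :
    u ≤ (shift p q ^ n) x ∧ (shift p q ^ n) x ≤ U := by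
  rw [← zpow_shift_eq_self hu n, ← zpow_shift_eq_self hU n, shift_zpow]
  exact ⟨shift_monotone _ _ hux, shift_monotone _ _ hxU⟩

/-- The translates of a transition from `U` to `u` cross every level between `u 0` and `U 0`. -/
theorem exists_crossing (hp : 1 ≤ p) (hu : u ∈ periodicSequences p q)
    (hU : U ∈ periodicSequences p q) {x : ℤ → ℝ} (hx : glue U u =ᶠ[cofinite] x) {c : ℝ}
    (hc : u 0 < c) (hc' : c < U 0) :
    ∃ k : ℤ, (shift p q ^ k) x 0 ≤ c ∧ c < shift p q ((shift p q ^ k) x) 0 := by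
  obtain ⟨i₀, i₁, -, hsupp⟩ := exists_support_subset_Icc hx
  have hout : ∀ j, j < i₀ ∨ i₁ < j → x j = glue U u j := fun j hj => by
    by_contra h
    have := hsupp (show j ∈ Function.support (x - glue U u) from sub_ne_zero.2 h)
    rw [Set.mem_Icc] at this
    omega
  have happ : ∀ (y : ℤ → ℝ) (k : ℤ), (shift p q ^ k) y 0 = y (0 - k * p) + (k * q : ℤ) :=
    fun y k => by rw [shift_zpow, shift_apply]
  have hright : ∀ k : ℤ, |i₀| < k → c < (shift p q ^ k) x 0 := by
    intro k hk
    have h0 := abs_nonneg i₀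
    have h1 : k ≤ k * p := le_mul_of_one_le_right (by omega) hp
    have h2 := neg_abs_le i₀
    rw [happ, hout _ (Or.inl (by omega)), glue_of_neg _ _ (by omega), ← happ,
      zpow_shift_eq_self hU]
    exact hc'
  have hleft : (shift p q ^ (-(|i₁| + 1))) x 0 ≤ c := by
    have h0 := abs_nonneg i₁
    have h1 : (|i₁| + 1) ≤ (|i₁| + 1) * p := le_mul_of_one_le_right (by omega) hp
    have h2 := le_abs_self i₁
    rw [happ, neg_mul, hout _ (Or.inr (by omega)), glue_of_nonneg _ _ (by omega), ← neg_mul,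
      ← happ, zpow_shift_eq_self hu]
    exact hc.le
  obtain ⟨k, hk, hmax⟩ := Int.exists_greatest_of_bdd
    (P := fun k => (shift p q ^ k) x 0 ≤ c)
    ⟨|i₀|, fun k hk => not_lt.1 fun h => (hright k h).not_ge hk⟩ ⟨_, hleft⟩
  refine ⟨k, hk, ?_⟩
  rw [← Equiv.Perm.mul_apply, ← zpow_one_add, add_comm]
  by_contra h
  have := hmax _ (not_lt.1 h)
  omega

theorem exists_transition (hS : IsTwistEnergy S) (hp : 1 ≤ p)
    (hu : u ∈ periodicMinimizers S p q) (hU : U ∈ periodicMinimizers S p q) (huU : u ≤ U)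
    {c : ℝ} (hc : u 0 < c) (hc' : c < U 0) :
    ∃ z ∈ globalMinimizers S, u ≤ z ∧ z ≤ U ∧ z 0 ≤ c ∧ c ≤ shift p q z 0 ∧
      ∀ k l : ℤ, shift k l u = u → shift k l U = U → z ≤ shift k l z ∨ shift k l z ≤ z := by
  have hug := periodicMinimizers_subset_globalMinimizers hS hp hu
  have hUg := periodicMinimizers_subset_globalMinimizers hS hp hU
  obtain ⟨e, he, x, hx, hlim⟩ := exists_minimizing_sequence hS hug hUg huU
  set h := glue U u with hh
  have hrel : ∀ (k l : ℤ), shift k l u = u → shift k l U = U → ∀ y, h =ᶠ[cofinite] y →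
      h =ᶠ[cofinite] shift k l y ∧ relAction S h (shift k l y) = relAction S h y := by
    intro k l hk hl y hy
    have h1 : h =ᶠ[cofinite] shift k l h := glue_eventuallyEq_shift hk hl
    have h2 := shift_eventuallyEq k l hy
    refine ⟨h1.trans h2, ?_⟩
    rw [← relAction_add h1 h2, relAction_shift hS, relAction_shift_glue hS hug hUg huU hk hl,
      zero_add]
  choose k hk using fun n => exists_crossing hp hu.1 hU.1 (hx n).1 hc hc'
  have hrelk : ∀ n, h =ᶠ[cofinite] (shift p q ^ k n) (x n) ∧
      relAction S h ((shift p q ^ k n) (x n)) = relAction S h (x n) := fun n => by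
    have h1 := zpow_shift_eq_self hu.1 (k n)
    have h2 := zpow_shift_eq_self hU.1 (k n)
    rw [shift_zpow] at h1 h2 ⊢
    exact hrel _ _ h1 h2 _ (hx n).1
  have hmem : ∀ n, (shift p q ^ k n) (x n) ∈ Set.Icc u U := fun n =>
    zpow_shift_mem_Icc hu.1 hU.1 (hx n).2.1 (hx n).2.2 _
  obtain ⟨z, hzmem, φ, hφ, hz⟩ := isCompact_Icc.tendsto_subseq hmem
  set w : ℕ → ℤ → ℝ := fun n => (shift p q ^ k (φ n)) (x (φ n)) with hw
  have hwlim : Tendsto (fun n => relAction S h (w n)) atTop (𝓝 e) := by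
    have : (fun n => relAction S h (w n)) = (fun n => relAction S h (x n)) ∘ φ :=
      funext fun n => (hrelk (φ n)).2
    rw [this]
    exact hlim.comp hφ.tendsto_atTop
  have hzlim : Tendsto w atTop (𝓝 z) := hz
  have hwh : ∀ n, h =ᶠ[cofinite] w n := fun n => (hrelk (φ n)).1
  have hzg : z ∈ globalMinimizers S := mem_globalMinimizers_of_minimizing hS he hwh hwlim hzlim
  have hshift : ∀ k l : ℤ, Tendsto (fun n => shift k l (w n)) atTop (𝓝 (shift k l z)) :=
    fun k l => ((continuous_shift k l).tendsto z).comp hzlim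
  refine ⟨z, hzg, hzmem.1, hzmem.2, ?_, ?_, fun k l hk hl => ?_⟩
  · exact le_of_tendsto' (tendsto_pi_nhds.1 hzlim 0) fun n => (hk (φ n)).1
  · exact ge_of_tendsto' (tendsto_pi_nhds.1 (hshift p q) 0) fun n => (hk (φ n)).2.le
  · have hwk := fun n => hrel k l hk hl _ (hwh n)
    have hinf : ∀ n, h =ᶠ[cofinite] w n ⊓ shift k l (w n) := fun n => by
      have := (hwh n).inf (hwk n).1
      rwa [inf_idem] at this
    have hsup : ∀ n, h =ᶠ[cofinite] w n ⊔ shift k l (w n) := fun n => by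
      have := (hwh n).sup (hwk n).1
      rwa [sup_idem] at this
    -- The translate has the same action as `w n`, and the sup has action at least e, so
    -- submodularity makes the inf minimizing as well.
    have hupper : ∀ n, relAction S h (w n ⊓ shift k l (w n)) ≤
        2 * relAction S h (w n) - e := fun n => by
      have h1 := relAction_submodular hS ((hwh n).symm.trans (hsup n))
      have h2 := relAction_add (S := S) (hwh n) ((hwh n).symm.trans (hsup n))
      have h3 := relAction_add (S := S) (hwk n).1 ((hwk n).1.symm.trans (hinf n))
      rw [(hwk n).2] at h3
      linarith [he _ (hsup n)]
    have hinflim : Tendsto (fun n => relAction S h (w n ⊓ shift k l (w n))) atTop (𝓝 e) := by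
      refine tendsto_of_tendsto_of_tendsto_of_le_of_le tendsto_const_nhds ?_
        (fun n => he _ (hinf n)) hupper
      have := (hwlim.const_mul 2).sub (tendsto_const_nhds (x := e))
      rwa [two_mul, add_sub_cancel_right] at this
    have hzinf : z ⊓ shift k l z ∈ globalMinimizers S :=
      mem_globalMinimizers_of_minimizing hS he hinf hinflim (tendsto_pi_nhds.2 fun i =>
        (tendsto_pi_nhds.1 hzlim i).inf_nhds (tendsto_pi_nhds.1 (hshift k l) i))
    exact le_total_of_inf_mem hS hzg (shift_mem_globalMinimizers hS k l hzg) hzinf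

/-- The deviations of u and U from the line of slope q / p are periodic, hence bounded, and x is
squeezed between them. -/
theorem hasRotationNumber_of_mem_Icc (hp : 1 ≤ p) (hu : u ∈ periodicSequences p q)
    (hU : U ∈ periodicSequences p q) {x : ℤ → ℝ} (hux : u ≤ x) (hxU : x ≤ U) :
    HasRotationNumber x ((q : ℝ) / p) := by
  have hp0 : (p : ℝ) ≠ 0 := by
    have : p ≠ 0 := by omega
    exact_mod_cast this
  have hper : ∀ y ∈ periodicSequences p q, ∃ B, ∀ i : ℤ, |y i - q / p * i| ≤ B := by
    intro y hy
    obtain ⟨B, hB⟩ := ((Set.finite_Ico (0 : ℤ) p).image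
      fun i => |y i - (q : ℝ) / p * i|).bddAbove
    refine ⟨B, fun i => ?_⟩
    have h1 := congrFun (zpow_shift_eq_self hy (i / p)) i
    rw [shift_zpow, shift_apply] at h1
    have h2 : i - i / p * p = i % p := by
      have := Int.mul_ediv_add_emod i p
      linarith
    have h3 : (i : ℝ) = ((i % p : ℤ) : ℝ) + ((i / p : ℤ) : ℝ) * p := by
      have := Int.mul_ediv_add_emod i p
      exact_mod_cast (by linarith : i = i % p + i / p * p)
    have h4 : y i - (q : ℝ) / p * i = y (i % p) - (q : ℝ) / p * ((i % p : ℤ) : ℝ) := by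
      rw [← h1, h2]
      conv_lhs => rw [h3]
      push_cast
      field_simp
      ring
    rw [h4]
    exact hB ⟨i % p, ⟨Int.emod_nonneg i (by omega), Int.emod_lt_of_pos i (by omega)⟩, rfl⟩
  obtain ⟨B₁, h1⟩ := hper u hu
  obtain ⟨B₂, h2⟩ := hper U hU
  have hbound : ∀ i : ℤ, |x i - q / p * i| ≤ max B₁ B₂ := fun i => by
    rw [abs_le]
    have a1 := abs_le.1 (h1 i)
    have a2 := abs_le.1 (h2 i)
    have := le_max_left B₁ B₂
    have := le_max_right B₁ B₂
    constructor <;> linarith [hux i, hxU i]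
  have hlim : ∀ F : Filter ℤ, Tendsto (fun n : ℤ => |(n : ℝ)|) F atTop →
      (∀ᶠ n : ℤ in F, n ≠ 0) → Tendsto (fun n : ℤ => x n / (n : ℝ)) F (𝓝 ((q : ℝ) / p)) := by
    intro F hF hF0
    rw [tendsto_iff_norm_sub_tendsto_zero]
    refine squeeze_zero' (Eventually.of_forall fun _ => norm_nonneg _) ?_
      (Tendsto.const_div_atTop hF (max B₁ B₂))
    filter_upwards [hF0] with n hn
    have hn' : (n : ℝ) ≠ 0 := by exact_mod_cast hn
    rw [Real.norm_eq_abs, div_sub' hn', abs_div]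
    rw [mul_comm (n : ℝ)]
    exact div_le_div_of_nonneg_right (hbound n) (abs_nonneg _)
  refine ⟨hlim _ ?_ (eventually_ne_atTop 0), hlim _ ?_ (eventually_ne_atBot 0)⟩
  · exact tendsto_abs_atTop_atTop.comp tendsto_intCast_atTop_atTop
  · exact tendsto_abs_atBot_atTop.comp (tendsto_intCast_atBot_iff.2 tendsto_id)

/-- Adjacent periodic minimizers: nothing lies strictly in between. -/
theorem eq_or_eq_of_gap (hS : IsTwistEnergy S) (hp : 1 ≤ p)
    (hu : u ∈ periodicMinimizers S p q) (hU : U ∈ periodicMinimizers S p q)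
    (hgap : ¬ ∃ y ∈ periodicMinimizers S p q, StrongLT u y ∧ StrongLT y U) {y : ℤ → ℝ}
    (hy : y ∈ periodicMinimizers S p q) (huy : u ≤ y) (hyU : y ≤ U) : y = u ∨ y = U := by
  have hsub := periodicMinimizers_subset_globalMinimizers (q := q) hS hp
  by_contra hne
  rw [not_or] at hne
  exact hgap ⟨y, hy, strongLT_of_lt hS (hsub hu) (hsub hy) (lt_of_le_of_ne huy (Ne.symm hne.1)),
    strongLT_of_lt hS (hsub hy) (hsub hU) (lt_of_le_of_ne hyU hne.2)⟩

theorem le_or_le_of_gap (hS : IsTwistEnergy S) (hp : 1 ≤ p)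
    (hu : u ∈ periodicMinimizers S p q) (hU : U ∈ periodicMinimizers S p q)
    (hgap : ¬ ∃ y ∈ periodicMinimizers S p q, StrongLT u y ∧ StrongLT y U) {y : ℤ → ℝ}
    (hy : y ∈ periodicMinimizers S p q) : y ≤ u ∨ U ≤ y := by
  rcases periodicMinimizers_le_total hS hp hy hu with h | h
  · exact Or.inl h
  rcases periodicMinimizers_le_total hS hp hy hU with h' | h'
  · rcases eq_or_eq_of_gap hS hp hu hU hgap hy h h' with rfl | rfl
    · exact Or.inl le_rfl
    · exact Or.inr le_rfl
  · exact Or.inr h'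

/-- Translates of u and U are periodic minimizers, so none lies strictly inside the gap. A
translation therefore carries [u, U] below u, above U, or onto itself with both ends fixed; only the
last case needs `hz`. -/
theorem birkhoff_of_gap (hS : IsTwistEnergy S) (hp : 1 ≤ p)
    (hu : u ∈ periodicMinimizers S p q) (hU : U ∈ periodicMinimizers S p q) (huU : u < U)
    (hgap : ¬ ∃ y ∈ periodicMinimizers S p q, StrongLT u y ∧ StrongLT y U) {z : ℤ → ℝ}
    (huz : u ≤ z) (hzU : z ≤ U)
    (hz : ∀ k l : ℤ, shift k l u = u → shift k l U = U → z ≤ shift k l z ∨ shift k l z ≤ z) :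
    z ∈ birkhoffSequences := by
  intro k l
  have hmono := shift_monotone k l
  have hmono' := shift_monotone (-k) (-l)
  rcases le_or_le_of_gap hS hp hu hU hgap (shift_mem_periodicMinimizers hS (by omega) hu k l)
    with h1 | h1
  · rcases le_or_le_of_gap hS hp hu hU hgap
      (shift_mem_periodicMinimizers hS (by omega) hU k l) with h2 | h2
    · exact Or.inl ((hmono hzU).trans (h2.trans huz))
    -- Here the translated gap contains [u, U]. The inverse translation maps both ends into [u, U]
    -- in order, hence fixes them.
    · have h3 := hmono' h1
      have h4 := hmono' h2
      rw [shift_neg_shift] at h3 h4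
      have h5 := hmono' huU.le
      have e1 : shift (-k) (-l) U = U := by
        refine (eq_or_eq_of_gap hS hp hu hU hgap (shift_mem_periodicMinimizers hS (by omega) hU
          (-k) (-l)) (h3.trans h5) h4).resolve_left fun h => ?_
        have : shift (-k) (-l) u = shift (-k) (-l) U := le_antisymm h5 (h ▸ h3)
        exact huU.ne ((shift (-k) (-l)).injective this)
      have e2 : shift (-k) (-l) u = u := by
        refine (eq_or_eq_of_gap hS hp hu hU hgap (shift_mem_periodicMinimizers hS (by omega) hu
          (-k) (-l)) h3 (h5.trans h4)).resolve_right fun h => ?_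
        exact huU.ne ((shift (-k) (-l)).injective (h.trans e1.symm))
      have e3 : shift k l u = u := by
        conv_lhs => rw [← e2, shift_shift_neg]
      have e4 : shift k l U = U := by
        conv_lhs => rw [← e1, shift_shift_neg]
      exact (hz k l e3 e4).symm
  · exact Or.inr (hzU.trans (h1.trans (hmono huz)))

theorem shift_succ_limit {F : Filter ℤ} [F.NeBot] (hF : Tendsto (fun n : ℤ => n + 1) F F)
    {z w : ℤ → ℝ} (hw : Tendsto (fun n : ℤ => (shift p q ^ n) z) F (𝓝 w)) :
    w ∈ periodicSequences p q := by
  have h1 := ((continuous_shift p q).tendsto w).comp hw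
  have h2 := hw.comp hF
  refine tendsto_nhds_unique (h1.congr fun n => ?_) h2
  simp only [Function.comp_apply]
  rw [← Equiv.Perm.mul_apply, ← zpow_one_add, add_comm]

theorem exists_heteroclinic (hS : IsTwistEnergy S) (hp : 1 ≤ p)
    (hu : u ∈ periodicMinimizers S p q) (hU : U ∈ periodicMinimizers S p q) (huU : u < U)
    (hgap : ¬ ∃ y ∈ periodicMinimizers S p q, StrongLT u y ∧ StrongLT y U) :
    ∃ z ∈ globalMinimizers S, z ∈ birkhoffSequences ∧ z ∉ periodicMinimizers S p q ∧
      u ≤ z ∧ z ≤ U ∧ z ≤ shift p q z ∧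
      Tendsto (fun n : ℤ => (shift p q ^ n) z) atTop (𝓝 U) ∧
      Tendsto (fun n : ℤ => (shift p q ^ n) z) atBot (𝓝 u) := by
  have hsub := periodicMinimizers_subset_globalMinimizers (q := q) hS hp
  have h0 : u 0 < U 0 := strongLT_of_lt hS (hsub hu) (hsub hU) huU 0
  obtain ⟨c, hc, hc'⟩ := exists_between h0
  obtain ⟨z, hzg, huz, hzU, hz0, hz1, hord⟩ := exists_transition hS hp hu hU huU.le hc hc'
  have hzle : z ≤ shift p q z := by
    rcases hord p q hu.1 hU.1 with h | h
    · exact h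
    -- If τz ≤ z, then z 0 ≤ c ≤ (τz) 0 makes the two touch at site 0, so they are equal.
    · exact (eq_of_touching hS (shift_mem_globalMinimizers hS p q hzg) hzg h (i := 0)
        (le_antisymm (h 0) (hz0.trans hz1))).ge
  have hgapeq : ∀ y ∈ periodicMinimizers S p q, u ≤ y → y ≤ U → y = u ∨ y = U :=
    fun y => eq_or_eq_of_gap hS hp hu hU hgap
  have hnot : z ∉ periodicMinimizers S p q := by
    intro hz
    rw [show shift p q z = z from hz.1] at hz1
    rcases hgapeq z hz huz hzU with h | h
    · rw [h] at hz1
      exact hc.not_ge hz1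
    · rw [h] at hz0
      exact hc'.not_ge hz0
  have hIcc : ∀ n : ℤ, u ≤ (shift p q ^ n) z ∧ (shift p q ^ n) z ≤ U :=
    zpow_shift_mem_Icc hu.1 hU.1 huz hzU
  have hmono : ∀ i, Monotone fun n : ℤ => (shift p q ^ n) z i := fun i =>
    monotone_int_of_le_succ fun n => by
      rw [zpow_add_one, Equiv.Perm.mul_apply, shift_zpow]
      exact shift_monotone _ _ hzle i
  have hlimmem : ∀ (F : Filter ℤ) [F.NeBot] (w : ℤ → ℝ), Tendsto (fun n : ℤ => n + 1) F F →
      Tendsto (fun n : ℤ => (shift p q ^ n) z) F (𝓝 w) → w = u ∨ w = U := by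
    intro F _ w hF hw
    have h1 : u ≤ w := ge_of_tendsto' hw fun n => (hIcc n).1
    have h2 : w ≤ U := le_of_tendsto' hw fun n => (hIcc n).2
    have h3 : w ∈ globalMinimizers S := isClosed_globalMinimizers hS (fun n => by
      rw [shift_zpow]
      exact shift_mem_globalMinimizers hS _ _ hzg) hw
    exact hgapeq w (mem_periodicMinimizers_of_mem_globalMinimizers hS hp hu h3
      (shift_succ_limit hF hw) h1) h1 h2
  refine ⟨z, hzg, birkhoff_of_gap hS hp hu hU huU hgap huz hzU hord, hnot, huz, hzU, hzle,
    ?_, ?_⟩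
  · have hlim : Tendsto (fun n : ℤ => (shift p q ^ n) z) atTop
        (𝓝 fun i => ⨆ n : ℤ, (shift p q ^ n) z i) := tendsto_pi_nhds.2 fun i =>
      tendsto_atTop_ciSup (hmono i) ⟨U i, Set.forall_mem_range.2 fun n => (hIcc n).2 i⟩
    rcases hlimmem _ _ (tendsto_atTop_add_const_right _ 1 tendsto_id) hlim with h | h
    · rw [h] at hlim
      -- The upper limit dominates τz, which is at least c > u 0 at site 0; dually, the lower limit
      -- is at most z 0 ≤ c < U 0.
      have h1 := (hmono 0).ge_of_tendsto (tendsto_pi_nhds.1 hlim 0) 1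
      rw [zpow_one] at h1
      exact absurd (hz1.trans h1) hc.not_ge
    · rwa [h] at hlim
  · have hlim : Tendsto (fun n : ℤ => (shift p q ^ n) z) atBot
        (𝓝 fun i => ⨅ n : ℤ, (shift p q ^ n) z i) := tendsto_pi_nhds.2 fun i =>
      tendsto_atBot_ciInf (hmono i) ⟨u i, Set.forall_mem_range.2 fun n => (hIcc n).1 i⟩
    rcases hlimmem _ _ (tendsto_atBot_add_const_right _ 1 tendsto_id) hlim with h | h
    · rwa [h] at hlim
    · rw [h] at hlim
      have h1 := (hmono 0).le_of_tendsto (tendsto_pi_nhds.1 hlim 0) 0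
      rw [zpow_zero] at h1
      exact absurd (h1.trans hz0) hc'.not_ge

/-! ### Reflection x ↦ -x -/

section Negation

theorem shift_neg_apply (k l : ℤ) (x : ℤ → ℝ) : shift k (-l) (-x) = -shift k l x := by
  funext i
  simp only [shift_apply, Pi.neg_apply]
  push_cast
  ring

theorem neg_mem_periodicSequences_iff {x : ℤ → ℝ} :
    -x ∈ periodicSequences p (-q) ↔ x ∈ periodicSequences p q := by
  change shift p (-q) (-x) = -x ↔ shift p q x = x
  rw [shift_neg_apply, neg_inj]

theorem siteEnergy_comp_neg (S : (Fin (r + 1) → ℝ) → ℝ) (i : ℤ) (x : ℤ → ℝ) :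
    siteEnergy (fun ξ => S (-ξ)) i x = siteEnergy S i (-x) := rfl

theorem neg_mem_periodicMinimizers_iff {x : ℤ → ℝ} :
    -x ∈ periodicMinimizers (fun ξ => S (-ξ)) p (-q) ↔ x ∈ periodicMinimizers S p q := by
  have hact : ∀ y, periodicAction (fun ξ => S (-ξ)) p (-y) = periodicAction S p y := fun y => by
    simp only [periodicAction, siteEnergy_comp_neg, neg_neg]
  constructor
  · refine fun h => ⟨neg_mem_periodicSequences_iff.1 h.1, fun y hy => ?_⟩
    rw [← hact, ← hact]
    exact h.2 _ (neg_mem_periodicSequences_iff.2 hy)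
  · refine fun h => ⟨neg_mem_periodicSequences_iff.2 h.1, fun y hy => ?_⟩
    rw [← neg_neg y] at hy ⊢
    rw [hact, hact]
    exact h.2 _ (neg_mem_periodicSequences_iff.1 hy)

theorem neg_mem_globalMinimizers {x : ℤ → ℝ}
    (hx : x ∈ globalMinimizers (fun ξ => S (-ξ))) : -x ∈ globalMinimizers S := by
  intro i₀ i₁ h v hv
  have h1 := hx i₀ i₁ h (-v) (by rwa [Function.support_neg])
  simp only [segmentAction, siteEnergy_comp_neg] at h1
  rwa [neg_add, neg_neg] at h1

theorem neg_mem_birkhoffSequences {x : ℤ → ℝ} (hx : x ∈ birkhoffSequences) :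
    -x ∈ birkhoffSequences := by
  intro k l
  rw [← neg_neg l, shift_neg_apply]
  exact (hx k (-l)).symm.imp neg_le_neg neg_le_neg

end Negation

end AubryMather

theorem mainTheorem8 (r : ℕ) (S : (Fin (r + 1) → ℝ) → ℝ) (hS : IsLocalEnergy r S)
    (p q : ℤ) (hp : 1 ≤ p) (xm xp : ℤ → ℝ)
    (hxm : xm ∈ periodicMinimizers S p q) (hxp : xp ∈ periodicMinimizers S p q)
    (hlt : xm < xp)
    (hgap : ¬ ∃ y ∈ periodicMinimizers S p q, StrongLT xm y ∧ StrongLT y xp) :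
    ∃ x ∈ birkhoffMinimizersPlus S p q \ periodicMinimizers S p q,
    ∃ x' ∈ birkhoffMinimizersMinus S p q \ periodicMinimizers S p q,
      (Tendsto (fun n : ℤ => (shift p q ^ n) x) atTop (𝓝 xp) ∧
        Tendsto (fun n : ℤ => (shift p q ^ n) x') atBot (𝓝 xp)) ∧
      (Tendsto (fun n : ℤ => (shift p q ^ n) x) atBot (𝓝 xm) ∧
        Tendsto (fun n : ℤ => (shift p q ^ n) x') atTop (𝓝 xm)) := by
  have hS' := hS.isTwistEnergy
  obtain ⟨x, hx1, hx2, hx3, hx4, hx5, hx6, hx7, hx8⟩ :=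
    exists_heteroclinic hS' hp hxm hxp hlt hgap
  -- The reflected energy has the gap (-`xp`, -`xm`) of period (p, -q). Negating its increasing
  -- heteroclinic gives a decreasing one for S.
  obtain ⟨y, hy1, hy2, hy3, hy4, hy5, hy6, hy7, hy8⟩ :=
    exists_heteroclinic hS'.comp_neg hp (neg_mem_periodicMinimizers_iff.2 hxp)
      (neg_mem_periodicMinimizers_iff.2 hxm) (neg_lt_neg hlt) (by
        rintro ⟨y, hy, h1, h2⟩
        rw [← neg_neg y, neg_mem_periodicMinimizers_iff] at hy
        exact hgap ⟨-y, hy, fun i => lt_neg.1 (h2 i), fun i => neg_lt.1 (h1 i)⟩)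
  have hneg : ∀ n : ℤ, (shift p q ^ n) (-y) = -(shift p (-q) ^ n) y := fun n => by
    rw [shift_zpow, shift_zpow, ← shift_neg_apply, mul_neg, neg_neg]
  refine ⟨x, ⟨⟨⟨hx1, hx2, hasRotationNumber_of_mem_Icc hp hxm.1 hxp.1 hx4 hx5⟩, hx6⟩, hx3⟩,
    -y, ⟨⟨⟨neg_mem_globalMinimizers hy1, neg_mem_birkhoffSequences hy2,
      hasRotationNumber_of_mem_Icc hp hxm.1 hxp.1 (le_neg.1 hy5) (neg_le.1 hy4)⟩, ?_⟩, ?_⟩,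
    ⟨hx7, ?_⟩, hx8, ?_⟩
  · have := hneg 1
    rw [zpow_one, zpow_one] at this
    rw [this]
    exact neg_le_neg hy6
  · rwa [← neg_mem_periodicMinimizers_iff, neg_neg]
  · simp only [hneg]
    simpa using hy8.neg
  · simp only [hneg]
    simpa using hy7.neg
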